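/- Let $M\subset\mathbb R^5$ be open, with coordinates $(x,y,p,q,z)$, let $\varepsilon>0$, and let $f=f(x,y,p)$ and $h=h(x,y)$ be smooth functions on the corresponding projections of $M$. On $M$ consider the $1$-forms $$\theta^1=dy-p\,dx,\quad \theta^2=dz-(q^2+f+hz)\,dx-\tfrac{\sqrt2}{2}\,q\,\theta^3,\quad \theta^3=2\sqrt2\,(dp-q\,dx),\quad \theta^4=3\,dx,$$ $$\theta^5=\tfrac{\sqrt2\,h}{2}\,\theta^3-6\,dq+3(2hq+f_p)\,dx+\tfrac1{10}\bigl(9f_{pp}+4h^2-6(ph_y+h_x)\bigr)\theta^1,$$ and the metric $g_{\mathcal D_{f,h}}=2\theta^1\theta^5-2\theta^2\theta^4+(\theta^3)^2$, which represents the conformal class $[g_{\mathcal D_{f,h}}]=\{e^{2\phi}g_{\mathcal D_{f,h}} : \phi\in C^\infty(M)\}$ associated with the rank 2 distribution $\mathcal D_{f,h}=\mathrm{Span}(\partial_q,\ \partial_x+p\,\partial_y+q\,\partial_p+(q^2+f+hz)\,\partial_z)$. (Products of $1$-forms are symmetric products, $\alpha\beta=\frac12(\alpha\otimes\beta+\beta\otimes\alpha)$.)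 An ambient metric for a metric $g_0$ on $M$ is a smooth Ricci-flat semi-Riemannian metric on $\widetilde M=(0,\infty)\times M\times(-\varepsilon,\varepsilon)$, with coordinates $(t,x^i,\varrho)$, of the form $2\,dt\,d(\varrho t)+t^2g(x^i,\varrho)$ with $g(x^i,0)=g_0$; an ambient metric for a conformal class is an ambient metric for some metric in that class. Let $A,B,C$ be smooth functions of $(x,y,p,\varrho)$ on the corresponding projection of $M\times(-\varepsilon,\varepsilon)$. Then $$\tilde g=2\,dt\,d(\varrho t)+t^2\bigl(g_{\mathcal D_{f,h}}+A\,(\theta^1)^2+2B\,\theta^1\theta^4+C\,(\theta^4)^2\bigr)$$ is an ambient metric for $[g_{\mathcal D_{f,h}}]$ if and only if $A|_{\varrho=0}\equiv0$, $B|_{\varrho=0}\equiv0$, $C|_{\varrho=0}\equiv0$ and, for all $(x,y,p,q,z)\in M$ and $\varrho\in(-\varepsilon,\varepsilon)$, $$\begin{aligned} LA&=\tfrac{9}{40}f_{pppp},\\ LB&=-\tfrac1{36}A_p+\tfrac3{40}f_{ppp}+\tfrac9{20}h_y,\\ LC&=-\tfrac1{18}B_p+\tfrac1{324}A+\tfrac1{30}f_{pp}-\tfrac2{15}h^2+\tfrac15(ph_y+h_x),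 \end{aligned}$$ where $L=2\varrho\,\partial_\varrho^2-3\,\partial_\varrho-\tfrac18\,\partial_p^2$. -/

import Mathlib

open scoped ContDiff

noncomputable section

namespace DistAmbient

/-! ### Tensor calculus in coordinates on open subsets of `ℝⁿ`

A symmetric `(0,2)`-tensor field is given by its coordinate matrix, a `1`-form by the row of its
components with respect to the coordinate differentials. -/

/-- The partial derivative `∂ᵢ F` at the point `u`. -/
def pd {n : ℕ} (i : Fin n) (F : (Fin n → ℝ) → ℝ) (u : Fin n → ℝ) : ℝ :=
  fderiv ℝ F u (Pi.single i 1)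

/-- The components of the coordinate differential `duⁱ`. -/
def dc {n : ℕ} (i : Fin n) : Fin n → ℝ := Pi.single i 1

/-- The symmetric product `α β = ½ (α ⊗ β + β ⊗ α)` of two covectors, so that `α α = α ⊗ α`. -/
def symProd {n : ℕ} (α β : Fin n → ℝ) : Matrix (Fin n) (Fin n) ℝ :=
  (1 / 2 : ℝ) • (Matrix.vecMulVec α β + Matrix.vecMulVec β α)

/-- A smooth semi-Riemannian metric on `U`: a smooth field of nondegenerate symmetric bilinear
forms of constant signature (at each point it is congruent to one fixed diagonal matrix with
entries `±1`). -/
def IsSemiRiemannianMetricOn {n : ℕ} (U : Set (Fin n → ℝ))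
    (g : (Fin n → ℝ) → Matrix (Fin n) (Fin n) ℝ) : Prop :=
  (∀ i j, ContDiffOn ℝ ∞ (fun u => g u i j) U) ∧
  ∃ s : Fin n → ℤˣ, ∀ u ∈ U, ∃ E : Matrix (Fin n) (Fin n) ℝ, IsUnit E.det ∧
    E.transpose * g u * E = Matrix.diagonal (fun i => ((s i : ℤ) : ℝ))

/-- The Christoffel symbols `Γᵏᵢⱼ = ½ ∑ₗ gᵏˡ (∂ᵢ gⱼₗ + ∂ⱼ gᵢₗ - ∂ₗ gᵢⱼ)`. -/
def christoffel {n : ℕ} (g : (Fin n → ℝ) → Matrix (Fin n) (Fin n) ℝ) (k i j : Fin n)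
    (u : Fin n → ℝ) : ℝ :=
  (1 / 2) * ∑ l, (g u)⁻¹ k l *
    (pd i (fun w => g w j l) u + pd j (fun w => g w i l) u - pd l (fun w => g w i j) u)

/-- The Ricci tensor
`Ricⱼₖ = ∑ᵢ (∂ᵢ Γⁱⱼₖ - ∂ₖ Γⁱⱼᵢ) + ∑ᵢₗ (Γⁱᵢₗ Γˡⱼₖ - Γⁱₖₗ Γˡⱼᵢ)`. -/
def ricci {n : ℕ} (g : (Fin n → ℝ) → Matrix (Fin n) (Fin n) ℝ) (u : Fin n → ℝ) :
    Matrix (Fin n) (Fin n) ℝ :=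
  Matrix.of fun j k =>
    (∑ i, (pd i (christoffel g i j k) u - pd k (christoffel g i j i) u)) +
    ∑ i, ∑ l, (christoffel g i i l u * christoffel g l j k u -
      christoffel g i k l u * christoffel g l j i u)

/-- The conformal class `{e^{2φ} g₀ | φ ∈ C^∞(M)}` of a metric `g₀` on `M`. -/
def conformalClass {n : ℕ} (M : Set (Fin n → ℝ)) (g₀ : (Fin n → ℝ) → Matrix (Fin n) (Fin n) ℝ) :
    Set ((Fin n → ℝ) → Matrix (Fin n) (Fin n) ℝ) :=
  {g | ∃ φ : (Fin n → ℝ) → ℝ, ContDiffOn ℝ ∞ φ M ∧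
    ∀ u ∈ M, g u = Real.exp (2 * φ u) • g₀ u}

/-! ### Ambient metrics

Points of the ambient space are `v = (t, x¹, …, xⁿ, ϱ)`. -/

/-- The coordinates `(x¹, …, xⁿ)` of an ambient point. -/
def base {n : ℕ} (v : Fin (n + 2) → ℝ) : Fin n → ℝ := fun i => v i.succ.castSucc

/-- The coordinate `t` of an ambient point. -/
def tCoord {n : ℕ} (v : Fin (n + 2) → ℝ) : ℝ := v 0

/-- The coordinate `ϱ` of an ambient point. -/
def rhoCoord {n : ℕ} (v : Fin (n + 2) → ℝ) : ℝ := v (Fin.last (n + 1))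

/-- The ambient space `(0, ∞) × M × (-ε, ε)`. -/
def ambientSpace {n : ℕ} (M : Set (Fin n → ℝ)) (ε : ℝ) : Set (Fin (n + 2) → ℝ) :=
  {v | 0 < tCoord v ∧ base v ∈ M ∧ rhoCoord v ∈ Set.Ioo (-ε) ε}

/-- The Jacobian matrix of the projection `base`. -/
def baseJacobian (n : ℕ) : Matrix (Fin n) (Fin (n + 2)) ℝ :=
  Matrix.of fun i a => if a = i.succ.castSucc then 1 else 0

/-- The tensor field `2 dt d(ϱ t) + t² g(x, ϱ)`, where `d(ϱ t) = ϱ dt + t dϱ`. -/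
def ambientForm {n : ℕ} (g : (Fin n → ℝ) → ℝ → Matrix (Fin n) (Fin n) ℝ)
    (v : Fin (n + 2) → ℝ) : Matrix (Fin (n + 2)) (Fin (n + 2)) ℝ :=
  (2 : ℝ) • symProd (dc 0) (rhoCoord v • dc 0 + tCoord v • dc (Fin.last (n + 1))) +
  (tCoord v) ^ 2 •
    ((baseJacobian n).transpose * g (base v) (rhoCoord v) * baseJacobian n)

/-- `gt` is a pre-ambient metric for `g₀`, defined on `(0, ∞) × M × (-ε, ε)`. -/
def IsPreAmbientMetric {n : ℕ} (M : Set (Fin n → ℝ)) (ε : ℝ)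
    (g₀ : (Fin n → ℝ) → Matrix (Fin n) (Fin n) ℝ)
    (gt : (Fin (n + 2) → ℝ) → Matrix (Fin (n + 2)) (Fin (n + 2)) ℝ) : Prop :=
  IsSemiRiemannianMetricOn (ambientSpace M ε) gt ∧
  ∃ g : (Fin n → ℝ) → ℝ → Matrix (Fin n) (Fin n) ℝ,
    (∀ v ∈ ambientSpace M ε, gt v = ambientForm g v) ∧ ∀ u ∈ M, g u 0 = g₀ u

/-- `gt` is an ambient metric for `g₀`: a Ricci-flat pre-ambient metric. -/
def IsAmbientMetric {n : ℕ} (M : Set (Fin n → ℝ)) (ε : ℝ)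
    (g₀ : (Fin n → ℝ) → Matrix (Fin n) (Fin n) ℝ)
    (gt : (Fin (n + 2) → ℝ) → Matrix (Fin (n + 2)) (Fin (n + 2)) ℝ) : Prop :=
  IsPreAmbientMetric M ε g₀ gt ∧ ∀ v ∈ ambientSpace M ε, ricci gt v = 0

/-- `gt` is an ambient metric for a conformal class `c`: an ambient metric for one of the metrics
in the class. -/
def IsAmbientMetricForClass {n : ℕ} (M : Set (Fin n → ℝ)) (ε : ℝ)
    (c : Set ((Fin n → ℝ) → Matrix (Fin n) (Fin n) ℝ))
    (gt : (Fin (n + 2) → ℝ) → Matrix (Fin (n + 2)) (Fin (n + 2)) ℝ) : Prop :=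
  ∃ g₀ ∈ c, IsAmbientMetric M ε g₀ gt

/-! ### The conformal class of the distribution `D_{f,h}`

Points of `M ⊆ ℝ⁵` are `u = (x, y, p, q, z)`; `f` is a function of `(x, y, p)`, `h` is a function
of `(x, y)`, and `A`, `B`, `C` are functions of `(x, y, p, ϱ)`. -/

/-- The projection `(x, y, p, q, z) ↦ (x, y)`. -/
def xy (u : Fin 5 → ℝ) : Fin 2 → ℝ := ![u 0, u 1]

/-- The projection `(x, y, p, q, z) ↦ (x, y, p)`. -/
def xyp (u : Fin 5 → ℝ) : Fin 3 → ℝ := ![u 0, u 1, u 2]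

/-- The map `((x, y, p, q, z), ϱ) ↦ (x, y, p, ϱ)`. -/
def xypr (u : Fin 5 → ℝ) (r : ℝ) : Fin 4 → ℝ := ![u 0, u 1, u 2, r]

/-- `θ¹ = dy - p dx`. -/
def theta1 (u : Fin 5 → ℝ) : Fin 5 → ℝ := dc 1 - u 2 • dc 0

/-- `θ³ = 2√2 (dp - q dx)`. -/
def theta3 (u : Fin 5 → ℝ) : Fin 5 → ℝ := (2 * √2) • (dc 2 - u 3 • dc 0)

/-- `θ² = dz - (q² + f + h z) dx - (√2/2) q θ³`. -/
def theta2 (f : (Fin 3 → ℝ) → ℝ) (h : (Fin 2 → ℝ) → ℝ) (u : Fin 5 → ℝ) : Fin 5 → ℝ :=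
  dc 4 - (u 3 ^ 2 + f (xyp u) + h (xy u) * u 4) • dc 0 - (√2 / 2 * u 3) • theta3 u

/-- `θ⁴ = 3 dx`. -/
def theta4 (_u : Fin 5 → ℝ) : Fin 5 → ℝ := (3 : ℝ) • dc 0

/-- `θ⁵ = (√2 h/2) θ³ - 6 dq + 3 (2 h q + f_p) dx
  + (1/10) (9 f_pp + 4 h² - 6 (p h_y + h_x)) θ¹`. -/
def theta5 (f : (Fin 3 → ℝ) → ℝ) (h : (Fin 2 → ℝ) → ℝ) (u : Fin 5 → ℝ) : Fin 5 → ℝ :=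
  (√2 * h (xy u) / 2) • theta3 u - (6 : ℝ) • dc 3
    + (3 * (2 * h (xy u) * u 3 + pd 2 f (xyp u))) • dc 0
    + (1 / 10 * (9 * pd 2 (pd 2 f) (xyp u) + 4 * h (xy u) ^ 2
        - 6 * (u 2 * pd 1 h (xy u) + pd 0 h (xy u)))) • theta1 u

/-- The metric `g_{D_{f,h}} = 2 θ¹θ⁵ - 2 θ²θ⁴ + (θ³)²`, which represents the conformal class of
the distribution `D_{f,h} = Span(∂_q, ∂_x + p ∂_y + q ∂_p + (q² + f + h z) ∂_z)`. -/
def gD (f : (Fin 3 → ℝ) → ℝ) (h : (Fin 2 → ℝ) → ℝ) (u : Fin 5 → ℝ) :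
    Matrix (Fin 5) (Fin 5) ℝ :=
  (2 : ℝ) • symProd (theta1 u) (theta5 f h u)
    - (2 : ℝ) • symProd (theta2 f h u) (theta4 u)
    + symProd (theta3 u) (theta3 u)

/-- The `ϱ`-dependent family `g_{D_{f,h}} + A (θ¹)² + 2 B θ¹θ⁴ + C (θ⁴)²`. -/
def gDFamily (f : (Fin 3 → ℝ) → ℝ) (h : (Fin 2 → ℝ) → ℝ) (A B C : (Fin 4 → ℝ) → ℝ)
    (u : Fin 5 → ℝ) (r : ℝ) : Matrix (Fin 5) (Fin 5) ℝ :=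
  gD f h u + A (xypr u r) • symProd (theta1 u) (theta1 u)
    + (2 * B (xypr u r)) • symProd (theta1 u) (theta4 u)
    + C (xypr u r) • symProd (theta4 u) (theta4 u)

/-- The ansatz
`2 dt d(ϱ t) + t² (g_{D_{f,h}} + A (θ¹)² + 2 B θ¹θ⁴ + C (θ⁴)²)`. -/
def gtD (f : (Fin 3 → ℝ) → ℝ) (h : (Fin 2 → ℝ) → ℝ) (A B C : (Fin 4 → ℝ) → ℝ) :
    (Fin 7 → ℝ) → Matrix (Fin 7) (Fin 7) ℝ :=
  ambientForm (gDFamily f h A B C)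

/-- The operator `L = 2 ϱ ∂²/∂ϱ² - 3 ∂/∂ϱ - (1/8) ∂²/∂p²` on functions of `(x, y, p, ϱ)`. -/
def opL (U : (Fin 4 → ℝ) → ℝ) (w : Fin 4 → ℝ) : ℝ :=
  2 * w 3 * pd 3 (pd 3 U) w - 3 * pd 3 U w - 1 / 8 * pd 2 (pd 2 U) w

end DistAmbient

end

open DistAmbient

/-!
The ansatz is analysed with a moving frame in which its Gram matrix is constant. In the coframe
`dt, t θ¹, t (θ² - ½ C θ⁴), t θ³ / (2√2), t θ⁴, t (θ⁵ + ½ A θ¹ + B θ⁴), d(ϱ t)` the functions `A`,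
`B`, `C` are absorbed into the forms paired with `θ⁴` and `θ¹`, and the ansatz becomes a fixed
quadratic form `gram` (`gtD_eq`).

For any such coframe the Ricci tensor, defined through coordinate Christoffel symbols, can be read
off from the Levi-Civita connection in the frame: the metric torsion-free connection of the frame is
gauge-equivalent to the coordinate one (`IsLeviCivitaFrame.christoffel_eq`), curvature is tensorial
under this gauge transformation (`IsLeviCivitaFrame.coframe_mul_curv`), and contracting the second
structure equation gives `IsLeviCivitaFrame.ricci_frame`. For the ansatz the connection forms are
written down explicitly (`scaledConn`). They take values in `so(gram)`, so they are metric, and the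
first structure equation `coframeDeriv_torsion` identifies them as the Levi-Civita connection. Up to
a factor `t⁻¹` nothing depends on `t`, and the Ricci tensor turns out to have only the components
`Ric(e₁, e₁)`, `Ric(e₁, e₄)`, `Ric(e₄, e₄)` (`scaledRicci_eq`). These are
`½ t⁻²` times the differences of the two sides of the three equations of the system.

It remains to treat the condition at `ϱ = 0`. The coefficient of `dp²` in the family is `8` for all
`A`, `B`, `C`, so a metric of the conformal class that occurs at `ϱ = 0` has conformal factor `1`,
and then `A`, `B`, `C` vanish there (`coeff_eq_zero_of_conformal`). Conversely the constant matrix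
`gram` gives the ansatz a constant signature.
-/

noncomputable section

namespace DistAmbient

variable {n : ℕ}

/-! ### Partial derivatives -/

lemma pd_congr {U : Set (Fin n → ℝ)} (hU : IsOpen U) {F G : (Fin n → ℝ) → ℝ}
    (h : ∀ w ∈ U, F w = G w) {v : Fin n → ℝ} (hv : v ∈ U) (i : Fin n) : pd i F v = pd i G v := by
  have : F =ᶠ[nhds v] G := Filter.eventuallyEq_of_mem (hU.mem_nhds hv) h
  simp only [pd, this.fderiv_eq]

lemma pd_const (c : ℝ) (v : Fin n → ℝ) (i : Fin n) : pd i (fun _ => c) v = 0 := by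
  simp [pd]

lemma pd_coord (j : Fin n) (v : Fin n → ℝ) (i : Fin n) :
    pd i (fun w => w j) v = if j = i then 1 else 0 := by
  have h : HasFDerivAt (fun w : Fin n → ℝ => w j) (ContinuousLinearMap.proj j) v :=
    (ContinuousLinearMap.proj (R := ℝ) (φ := fun _ : Fin n => ℝ) j).hasFDerivAt
  simp [pd, h.fderiv, Pi.single_apply]

lemma pd_add {F G : (Fin n → ℝ) → ℝ} {v : Fin n → ℝ} (hF : DifferentiableAt ℝ F v)
    (hG : DifferentiableAt ℝ G v) (i : Fin n) :
    pd i (fun w => F w + G w) v = pd i F v + pd i G v := by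
  simp [pd, fderiv_fun_add hF hG]

lemma pd_mul {F G : (Fin n → ℝ) → ℝ} {v : Fin n → ℝ} (hF : DifferentiableAt ℝ F v)
    (hG : DifferentiableAt ℝ G v) (i : Fin n) :
    pd i (fun w => F w * G w) v = pd i F v * G v + F v * pd i G v := by
  simp [pd, fderiv_fun_mul hF hG]; ring

lemma pd_sum {ι : Type*} (s : Finset ι) {F : ι → (Fin n → ℝ) → ℝ} {v : Fin n → ℝ}
    (hF : ∀ a ∈ s, DifferentiableAt ℝ (F a) v) (i : Fin n) :
    pd i (fun w => ∑ a ∈ s, F a w) v = ∑ a ∈ s, pd i (F a) v := by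
  simp [pd, fderiv_fun_sum hF]

/-- The derivative of `F` in the direction `X`. -/
def dirDeriv (X : Fin n → ℝ) (F : (Fin n → ℝ) → ℝ) (v : Fin n → ℝ) : ℝ := ∑ i, X i * pd i F v

section dirDeriv

variable {X v : Fin n → ℝ} {F G : (Fin n → ℝ) → ℝ}

lemma dirDeriv_eq_fderiv : dirDeriv X F v = fderiv ℝ F v X := by
  conv_rhs => rw [← Finset.univ_sum_single X, map_sum]
  refine Finset.sum_congr rfl fun i _ => ?_
  rw [show (Pi.single i (X i) : Fin n → ℝ) = X i • Pi.single i 1 by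
    rw [← Pi.single_smul, smul_eq_mul, mul_one], map_smul, smul_eq_mul, pd]

lemma dirDeriv_const (c : ℝ) : dirDeriv X (fun _ => c) v = 0 := by
  simp [dirDeriv_eq_fderiv]

lemma dirDeriv_coord (j : Fin n) : dirDeriv X (fun w => w j) v = X j := by
  simp [dirDeriv, pd_coord]

lemma dirDeriv_add (hF : DifferentiableAt ℝ F v) (hG : DifferentiableAt ℝ G v) :
    dirDeriv X (fun w => F w + G w) v = dirDeriv X F v + dirDeriv X G v := by
  simp [dirDeriv_eq_fderiv, fderiv_fun_add hF hG]

lemma dirDeriv_sub (hF : DifferentiableAt ℝ F v) (hG : DifferentiableAt ℝ G v) :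
    dirDeriv X (fun w => F w - G w) v = dirDeriv X F v - dirDeriv X G v := by
  simp [dirDeriv_eq_fderiv, fderiv_fun_sub hF hG]

lemma dirDeriv_neg : dirDeriv X (fun w => -F w) v = -dirDeriv X F v := by
  simp [dirDeriv_eq_fderiv, fderiv_fun_neg]

lemma dirDeriv_mul (hF : DifferentiableAt ℝ F v) (hG : DifferentiableAt ℝ G v) :
    dirDeriv X (fun w => F w * G w) v = dirDeriv X F v * G v + F v * dirDeriv X G v := by
  simp only [dirDeriv_eq_fderiv, fderiv_fun_mul hF hG, add_apply, smul_apply, smul_eq_mul]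
  ring

lemma dirDeriv_const_mul (c : ℝ) (hF : DifferentiableAt ℝ F v) :
    dirDeriv X (fun w => c * F w) v = c * dirDeriv X F v := by
  rw [dirDeriv_mul (differentiableAt_const c) hF, dirDeriv_const, zero_mul, zero_add]

end dirDeriv

lemma contDiffOn_pd {U : Set (Fin n → ℝ)} (hU : IsOpen U) {F : (Fin n → ℝ) → ℝ}
    (hF : ContDiffOn ℝ ∞ F U) (i : Fin n) : ContDiffOn ℝ ∞ (pd i F) U := by
  have h := hF.fderiv_of_isOpen hU (m := ∞) (by simp)
  exact h.clm_apply contDiffOn_const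

lemma differentiableAt_of_contDiffOn {U : Set (Fin n → ℝ)} (hU : IsOpen U)
    {F : (Fin n → ℝ) → ℝ} (hF : ContDiffOn ℝ ∞ F U) {v : Fin n → ℝ} (hv : v ∈ U) :
    DifferentiableAt ℝ F v :=
  (hF.contDiffAt (hU.mem_nhds hv)).differentiableAt (by simp)

lemma pd_comm {U : Set (Fin n → ℝ)} (hU : IsOpen U) {F : (Fin n → ℝ) → ℝ}
    (hF : ContDiffOn ℝ ∞ F U) {v : Fin n → ℝ} (hv : v ∈ U) (i j : Fin n) :
    pd i (pd j F) v = pd j (pd i F) v := by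
  have hF' := hF.contDiffAt (hU.mem_nhds hv)
  have hs : IsSymmSndFDerivAt ℝ F v :=
    hF'.isSymmSndFDerivAt (by simpa using WithTop.coe_le_coe.2 (le_top : (2 : ℕ∞) ≤ ⊤))
  have hd : DifferentiableAt ℝ (fderiv ℝ F) v :=
    (hF'.fderiv_right (m := ∞) (by simp)).differentiableAt (by simp)
  have key : ∀ a b : Fin n, pd a (pd b F) v
      = fderiv ℝ (fderiv ℝ F) v (Pi.single a 1) (Pi.single b 1) := by
    intro a b
    have : pd b F = fun w => fderiv ℝ F w (Pi.single b 1) := rfl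
    rw [this]
    simp only [pd]
    rw [fderiv_clm_apply hd (differentiableAt_const _)]
    simp
  rw [key, key]
  exact hs _ _

/-- The entrywise partial derivative of a matrix of functions. -/
def mpd {m l : Type*} (i : Fin n) (X : (Fin n → ℝ) → Matrix m l ℝ) (v : Fin n → ℝ) : Matrix m l ℝ :=
  Matrix.of fun a b => pd i (fun w => X w a b) v

/-- Entrywise differentiability of a matrix of functions at a point. -/
def MDiffAt {m l : Type*} (X : (Fin n → ℝ) → Matrix m l ℝ) (v : Fin n → ℝ) : Prop :=
  ∀ a b, DifferentiableAt ℝ (fun w => X w a b) v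

section Matrices

variable {l m k : Type*} [Fintype m]

lemma MDiffAt.mul {X : (Fin n → ℝ) → Matrix l m ℝ} {Y : (Fin n → ℝ) → Matrix m k ℝ}
    {v : Fin n → ℝ} (hX : MDiffAt X v) (hY : MDiffAt Y v) : MDiffAt (fun w => X w * Y w) v := by
  intro a b
  simp only [Matrix.mul_apply]
  exact DifferentiableAt.fun_sum fun c _ => (hX a c).mul (hY c b)

lemma MDiffAt.add {X Y : (Fin n → ℝ) → Matrix l k ℝ}
    {v : Fin n → ℝ} (hX : MDiffAt X v) (hY : MDiffAt Y v) : MDiffAt (fun w => X w + Y w) v := by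
  intro a b
  simp only [Matrix.add_apply]
  exact (hX a b).add (hY a b)

lemma mpd_mul {X : (Fin n → ℝ) → Matrix l m ℝ} {Y : (Fin n → ℝ) → Matrix m k ℝ}
    {v : Fin n → ℝ} (hX : MDiffAt X v) (hY : MDiffAt Y v) (i : Fin n) :
    mpd i (fun w => X w * Y w) v = mpd i X v * Y v + X v * mpd i Y v := by
  ext a b
  simp only [mpd, Matrix.mul_apply, Matrix.of_apply, Matrix.add_apply]
  rw [pd_sum Finset.univ (F := fun c w => X w a c * Y w c b) (fun c _ => (hX a c).mul (hY c b)),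
    ← Finset.sum_add_distrib]
  exact Finset.sum_congr rfl fun c _ => pd_mul (hX a c) (hY c b) i

lemma mpd_add {X Y : (Fin n → ℝ) → Matrix l k ℝ}
    {v : Fin n → ℝ} (hX : MDiffAt X v) (hY : MDiffAt Y v) (i : Fin n) :
    mpd i (fun w => X w + Y w) v = mpd i X v + mpd i Y v := by
  ext a b
  exact pd_add (hX a b) (hY a b) i

lemma mpd_congr {U : Set (Fin n → ℝ)} (hU : IsOpen U) {X Y : (Fin n → ℝ) → Matrix l k ℝ}
    (h : ∀ w ∈ U, X w = Y w) {v : Fin n → ℝ} (hv : v ∈ U) (i : Fin n) :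
    mpd i X v = mpd i Y v := by
  ext a b
  exact pd_congr hU (fun w hw => by rw [h w hw]) hv i

end Matrices

/-! ### The Ricci tensor in a moving frame -/

/-- The derivative `e_b(F)` along the frame field `e_b = ∑ᵢ Eⁱ_b ∂ᵢ`. -/
def frameDeriv (E : (Fin n → ℝ) → Matrix (Fin n) (Fin n) ℝ) (b : Fin n) (F : (Fin n → ℝ) → ℝ)
    (v : Fin n → ℝ) : ℝ :=
  dirDeriv (fun i => E v i b) F v

/-- A coframe `θᵃ = ∑ₖ Θₐₖ duᵏ` on `U` with dual frame `e_b = ∑ₖ Eₖ_b ∂ₖ`, for which the matrices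
`W c` represent the Levi-Civita connection `∇_{e_c} e_b = ∑ₐ (W c)ₐ_b e_a` of the metric
`∑ N_ab θᵃ θᵇ` with constant `N`: the connection is metric and torsion-free. -/
structure IsLeviCivitaFrame (U : Set (Fin n → ℝ)) (N : Matrix (Fin n) (Fin n) ℝ)
    (Θ E : (Fin n → ℝ) → Matrix (Fin n) (Fin n) ℝ)
    (W : Fin n → (Fin n → ℝ) → Matrix (Fin n) (Fin n) ℝ) : Prop where
  isOpen : IsOpen U
  isSymm : N.transpose = N
  isUnit : IsUnit N.det
  smooth : ∀ a k, ContDiffOn ℝ ∞ (fun v => Θ v a k) U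
  frame_diff : ∀ v ∈ U, MDiffAt E v
  conn_diff : ∀ c, ∀ v ∈ U, MDiffAt (W c) v
  dual : ∀ v ∈ U, Θ v * E v = 1
  metric : ∀ c, ∀ v ∈ U, N * W c v + (N * W c v).transpose = 0
  torsion : ∀ v ∈ U, ∀ a b c,
    ∑ k, (frameDeriv E b (fun w => Θ w a k) v * E v k c
      - frameDeriv E c (fun w => Θ w a k) v * E v k b) = W c v a b - W b v a c

namespace IsLeviCivitaFrame

variable {U : Set (Fin n → ℝ)} {N : Matrix (Fin n) (Fin n) ℝ}
  {Θ E : (Fin n → ℝ) → Matrix (Fin n) (Fin n) ℝ}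
  {W : Fin n → (Fin n → ℝ) → Matrix (Fin n) (Fin n) ℝ}

/-- The frame connection matrix in the coordinate direction `∂ₖ`. -/
def coordConn (Θ : (Fin n → ℝ) → Matrix (Fin n) (Fin n) ℝ)
    (W : Fin n → (Fin n → ℝ) → Matrix (Fin n) (Fin n) ℝ) (k : Fin n) (v : Fin n → ℝ) :
    Matrix (Fin n) (Fin n) ℝ :=
  ∑ c, Θ v c k • W c v

/-- The coordinate Christoffel symbols `Γⁱₖⱼ`, arranged as the matrix with entries `(i, j)`,
obtained from the frame connection by the gauge transformation `Θ`. -/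
def gauge (Θ E : (Fin n → ℝ) → Matrix (Fin n) (Fin n) ℝ)
    (W : Fin n → (Fin n → ℝ) → Matrix (Fin n) (Fin n) ℝ) (k : Fin n) (v : Fin n → ℝ) :
    Matrix (Fin n) (Fin n) ℝ :=
  E v * (coordConn Θ W k v * Θ v + mpd k Θ v)

lemma dual' (H : IsLeviCivitaFrame U N Θ E W) {v : Fin n → ℝ} (hv : v ∈ U) : E v * Θ v = 1 :=
  mul_eq_one_comm.mp (H.dual v hv)

lemma mDiffAt_coframe (H : IsLeviCivitaFrame U N Θ E W) {v : Fin n → ℝ} (hv : v ∈ U) :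
    MDiffAt Θ v := fun a k =>
  differentiableAt_of_contDiffOn H.isOpen (H.smooth a k) hv

lemma mDiffAt_mpd_coframe (H : IsLeviCivitaFrame U N Θ E W) {v : Fin n → ℝ} (hv : v ∈ U)
    (k : Fin n) : MDiffAt (mpd k Θ) v := fun a j =>
  differentiableAt_of_contDiffOn H.isOpen (contDiffOn_pd H.isOpen (H.smooth a j) k) hv

lemma mDiffAt_coordConn (H : IsLeviCivitaFrame U N Θ E W) {v : Fin n → ℝ} (hv : v ∈ U)
    (k : Fin n) : MDiffAt (coordConn Θ W k) v := by
  intro a b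
  simp only [coordConn, Matrix.sum_apply, Matrix.smul_apply, smul_eq_mul]
  exact DifferentiableAt.fun_sum fun c _ => (H.mDiffAt_coframe hv c k).mul (H.conn_diff c v hv a b)

lemma mDiffAt_gauge (H : IsLeviCivitaFrame U N Θ E W) {v : Fin n → ℝ} (hv : v ∈ U)
    (k : Fin n) : MDiffAt (gauge Θ E W k) v :=
  (H.frame_diff v hv).mul (((H.mDiffAt_coordConn hv k).mul (H.mDiffAt_coframe hv)).add
    (H.mDiffAt_mpd_coframe hv k))

/-- The gauge transformation between the coordinate and the frame description of the connection. -/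
lemma coframe_mul_gauge (H : IsLeviCivitaFrame U N Θ E W) {v : Fin n → ℝ} (hv : v ∈ U)
    (k : Fin n) : Θ v * gauge Θ E W k v = coordConn Θ W k v * Θ v + mpd k Θ v := by
  rw [gauge, ← Matrix.mul_assoc, H.dual v hv, Matrix.one_mul]

/-- The first structure equation in coordinates: `∇_{∂ₖ} ∂ⱼ` is symmetric in `j` and `k`. -/
lemma torsion_coord (H : IsLeviCivitaFrame U N Θ E W) {v : Fin n → ℝ} (hv : v ∈ U)
    (a j k : Fin n) : (coordConn Θ W k v * Θ v + mpd k Θ v) a j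
      = (coordConn Θ W j v * Θ v + mpd j Θ v) a k := by
  set D : Matrix (Fin n) (Fin n) ℝ := Matrix.of fun j k => pd j (fun w => Θ w a k) v with hD
  set S : Matrix (Fin n) (Fin n) ℝ := Matrix.of fun b c => W c v a b - W b v a c with hS
  have h1 : (E v).transpose * (D - D.transpose) * E v = S := by
    ext b c
    rw [hS, Matrix.of_apply, ← H.torsion v hv a b c, Matrix.mul_sub, Matrix.sub_mul,
      Matrix.sub_apply, Finset.sum_sub_distrib]
    refine congrArg₂ _ ?_ ?_
    · simp [Matrix.mul_apply, frameDeriv, dirDeriv, hD]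
    · rw [Matrix.mul_assoc, Matrix.mul_apply]
      refine Finset.sum_congr rfl fun i _ => ?_
      simp [Matrix.mul_apply, frameDeriv, dirDeriv, hD, Finset.mul_sum, mul_comm]
  have h2 : D - D.transpose = (Θ v).transpose * S * Θ v := by
    have h3 : (Θ v).transpose * (E v).transpose = 1 := by
      rw [← Matrix.transpose_mul, H.dual' hv, Matrix.transpose_one]
    rw [← h1]
    calc D - D.transpose = ((Θ v).transpose * (E v).transpose) * (D - D.transpose)
          * (E v * Θ v) := by rw [h3, H.dual' hv, Matrix.one_mul, Matrix.mul_one]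
      _ = _ := by simp only [Matrix.mul_assoc]
  have h4 := congrFun (congrFun h2 k) j
  have h5 : ∀ p q : Fin n, (coordConn Θ W p v * Θ v) a q
      = ∑ b, ∑ c, Θ v c p * W c v a b * Θ v b q := by
    intro p q
    simp [coordConn, Matrix.mul_apply, Matrix.sum_apply, Finset.sum_mul]
  have h6 : ((Θ v).transpose * S * Θ v) k j = ∑ b, ∑ c, Θ v c j * W c v a b * Θ v b k
      - ∑ b, ∑ c, Θ v c k * W c v a b * Θ v b j := by
    have h7 : ((Θ v).transpose * S * Θ v) k j
        = ∑ c, ∑ b, (Θ v c j * W c v a b * Θ v b k - Θ v c j * W b v a c * Θ v b k) := by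
      simp only [Matrix.mul_apply, Finset.sum_mul, hS, Matrix.of_apply, Matrix.transpose_apply]
      exact Finset.sum_congr rfl fun c _ => Finset.sum_congr rfl fun b _ => by ring
    rw [h7, Finset.sum_comm]
    simp only [Finset.sum_sub_distrib]
    congr 1
    rw [Finset.sum_comm]
    exact Finset.sum_congr rfl fun c _ => Finset.sum_congr rfl fun b _ => by ring
  rw [h6] at h4
  simp only [Matrix.add_apply, h5]
  simp only [Matrix.sub_apply, Matrix.transpose_apply, hD, Matrix.of_apply] at h4
  simp only [mpd, Matrix.of_apply]
  linarith

lemma gauge_symm (H : IsLeviCivitaFrame U N Θ E W) {v : Fin n → ℝ} (hv : v ∈ U)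
    (i j k : Fin n) : gauge Θ E W k v i j = gauge Θ E W j v i k := by
  simp only [gauge, Matrix.mul_apply (M := E v)]
  exact Finset.sum_congr rfl fun a _ => by rw [H.torsion_coord hv a j k]

/-- The gauge-transformed connection is metric: `∂ᵢ g = g Γᵢ + (g Γᵢ)ᵀ`. -/
lemma mpd_metric (H : IsLeviCivitaFrame U N Θ E W)
    {g : (Fin n → ℝ) → Matrix (Fin n) (Fin n) ℝ}
    (hg : ∀ v ∈ U, g v = (Θ v).transpose * N * Θ v) {v : Fin n → ℝ} (hv : v ∈ U) (i : Fin n) :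
    mpd i g v = g v * gauge Θ E W i v + (g v * gauge Θ E W i v).transpose := by
  have hΘ := H.mDiffAt_coframe hv
  have hT : MDiffAt (fun w => (Θ w).transpose) v := fun a b => hΘ b a
  have hN : MDiffAt (fun _ : Fin n → ℝ => N) v := fun a b => differentiableAt_const _
  have hN0 : mpd i (fun _ : Fin n → ℝ => N) v = 0 := by
    ext a b; exact pd_const _ _ _
  have hT' : mpd i (fun w => (Θ w).transpose) v = (mpd i Θ v).transpose := rfl
  rw [mpd_congr H.isOpen hg hv, mpd_mul (hT.mul hN) hΘ, mpd_mul hT hN, hN0, hT', hg v hv,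
    Matrix.mul_assoc (_ * N), H.coframe_mul_gauge hv]
  have hω : N * coordConn Θ W i v + (N * coordConn Θ W i v).transpose = 0 := by
    simp only [coordConn, Matrix.mul_sum, Matrix.transpose_sum, ← Finset.sum_add_distrib,
      Matrix.mul_smul, Matrix.transpose_smul, ← smul_add, H.metric _ v hv, smul_zero,
      Finset.sum_const_zero]
  have h1 := congrArg (fun X => (Θ v).transpose * X * Θ v) hω
  simp only [Matrix.transpose_mul, Matrix.mul_add, Matrix.add_mul, H.isSymm, Matrix.mul_zero,
    Matrix.zero_mul, Matrix.transpose_add, Matrix.transpose_transpose, Matrix.mul_assoc,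
    add_zero] at h1 ⊢
  rw [show ∀ a b c d : Matrix (Fin n) (Fin n) ℝ, a + b + (c + d) = (a + c) + (b + d) from
    fun a b c d => by abel, h1]
  abel

lemma isUnit_det_metric (H : IsLeviCivitaFrame U N Θ E W)
    {g : (Fin n → ℝ) → Matrix (Fin n) (Fin n) ℝ}
    (hg : ∀ v ∈ U, g v = (Θ v).transpose * N * Θ v) {v : Fin n → ℝ} (hv : v ∈ U) :
    IsUnit (g v).det := by
  have h := congrArg Matrix.det (H.dual v hv)
  rw [Matrix.det_mul, Matrix.det_one] at h
  have hΘ : IsUnit (Θ v).det := IsUnit.of_mul_eq_one _ h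
  rw [hg v hv, Matrix.det_mul, Matrix.det_mul, Matrix.det_transpose]
  exact (hΘ.mul H.isUnit).mul hΘ

/-- A metric torsion-free connection has the Christoffel symbols as its coefficients. -/
lemma christoffel_eq (H : IsLeviCivitaFrame U N Θ E W)
    {g : (Fin n → ℝ) → Matrix (Fin n) (Fin n) ℝ}
    (hg : ∀ v ∈ U, g v = (Θ v).transpose * N * Θ v) {v : Fin n → ℝ} (hv : v ∈ U)
    (k i j : Fin n) : christoffel g k i j v = gauge Θ E W i v k j := by
  have hsym : (g v).transpose = g v := by
    rw [hg v hv]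
    simp [Matrix.transpose_mul, H.isSymm, Matrix.mul_assoc]
  have hd : ∀ a b c, pd a (fun w => g w b c) v
      = (g v * gauge Θ E W a v) b c + (g v * gauge Θ E W a v) c b := fun a b c =>
    congrFun (congrFun (H.mpd_metric hg hv a) b) c
  have hs : ∀ a b c, (g v * gauge Θ E W a v) b c = (g v * gauge Θ E W c v) b a := by
    intro a b c
    simp only [Matrix.mul_apply]
    exact Finset.sum_congr rfl fun m _ => by rw [H.gauge_symm hv]
  have h1 : ∀ l, pd i (fun w => g w j l) v + pd j (fun w => g w i l) v - pd l (fun w => g w i j) v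
      = 2 * (g v * gauge Θ E W i v) l j := by
    intro l
    rw [hd, hd, hd, hs i j l, hs j i l, hs j l i]
    ring
  simp only [christoffel, h1]
  have h2 : (g v)⁻¹ * (g v * gauge Θ E W i v) = gauge Θ E W i v := by
    rw [← Matrix.mul_assoc, Matrix.nonsing_inv_mul _ (H.isUnit_det_metric hg hv), Matrix.one_mul]
  rw [← congrFun (congrFun h2 k) j, Matrix.mul_apply, Finset.mul_sum]
  exact Finset.sum_congr rfl fun l _ => by ring

/-- The curvature matrix `∂ᵢ Aₖ - ∂ₖ Aᵢ + [Aᵢ, Aₖ]` of a connection with matrices `Aₖ`. -/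
def curv (A : Fin n → (Fin n → ℝ) → Matrix (Fin n) (Fin n) ℝ) (i k : Fin n) (v : Fin n → ℝ) :
    Matrix (Fin n) (Fin n) ℝ :=
  mpd i (A k) v - mpd k (A i) v + (A i v * A k v - A k v * A i v)

/-- Curvature is tensorial under gauge transformations. -/
lemma coframe_mul_curv (H : IsLeviCivitaFrame U N Θ E W) {v : Fin n → ℝ} (hv : v ∈ U)
    (i k : Fin n) :
    Θ v * curv (gauge Θ E W) i k v = curv (coordConn Θ W) i k v * Θ v := by
  have hΘ := H.mDiffAt_coframe hv
  have hd : ∀ i k, mpd i Θ v * gauge Θ E W k v + Θ v * mpd i (gauge Θ E W k) v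
      = mpd i (coordConn Θ W k) v * Θ v + coordConn Θ W k v * mpd i Θ v + mpd i (mpd k Θ) v := by
    intro i k
    rw [← mpd_mul hΘ (H.mDiffAt_gauge hv k), ← mpd_mul (H.mDiffAt_coordConn hv k) hΘ,
      ← mpd_add ((H.mDiffAt_coordConn hv k).mul hΘ) (H.mDiffAt_mpd_coframe hv k)]
    exact mpd_congr H.isOpen (fun w hw => H.coframe_mul_gauge hw k) hv i
  have hc : mpd i (mpd k Θ) v = mpd k (mpd i Θ) v := by
    ext a b
    exact pd_comm H.isOpen (H.smooth a b) hv i k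
  have hm : ∀ i k, Θ v * (gauge Θ E W i v * gauge Θ E W k v)
      = coordConn Θ W i v * (coordConn Θ W k v * Θ v + mpd k Θ v)
        + mpd i Θ v * gauge Θ E W k v := by
    intro i k
    rw [← Matrix.mul_assoc, H.coframe_mul_gauge hv, Matrix.add_mul, Matrix.mul_assoc,
      H.coframe_mul_gauge hv]
  have e : ∀ i k, Θ v * mpd i (gauge Θ E W k) v = mpd i (coordConn Θ W k) v * Θ v
      + coordConn Θ W k v * mpd i Θ v + mpd i (mpd k Θ) v - mpd i Θ v * gauge Θ E W k v := by
    intro i k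
    rw [← hd i k]; abel
  simp only [curv, Matrix.mul_add, Matrix.mul_sub, Matrix.add_mul, Matrix.sub_mul, e, hm, hc,
    Matrix.mul_assoc]
  abel

lemma ricci_apply (H : IsLeviCivitaFrame U N Θ E W)
    {g : (Fin n → ℝ) → Matrix (Fin n) (Fin n) ℝ}
    (hg : ∀ v ∈ U, g v = (Θ v).transpose * N * Θ v) {v : Fin n → ℝ} (hv : v ∈ U)
    (j k : Fin n) : ricci g v j k = ∑ i, curv (gauge Θ E W) i k v i j := by
  have h1 : ∀ i a b c, pd i (christoffel g a b c) v = mpd i (gauge Θ E W c) v a b := by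
    intro i a b c
    refine pd_congr H.isOpen (fun w hw => ?_) hv i
    rw [H.christoffel_eq hg hw, H.gauge_symm hw]
  simp only [ricci, Matrix.of_apply, h1, H.christoffel_eq hg hv, ← Finset.sum_add_distrib, curv,
    Matrix.add_apply, Matrix.sub_apply, Matrix.mul_apply]
  refine Finset.sum_congr rfl fun i _ => ?_
  rw [← Finset.sum_sub_distrib]
  congr 1
  refine Finset.sum_congr rfl fun l _ => ?_
  rw [H.gauge_symm hv l k j, H.gauge_symm hv l i j]

/-- The Ricci tensor `Ric(e_b, e_c)` computed from the connection coefficients of a frame. -/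
def frameRicci (E : (Fin n → ℝ) → Matrix (Fin n) (Fin n) ℝ)
    (W : Fin n → (Fin n → ℝ) → Matrix (Fin n) (Fin n) ℝ) (v : Fin n → ℝ) (b c : Fin n) : ℝ :=
  ∑ a, (frameDeriv E a (fun w => W c w a b) v - frameDeriv E c (fun w => W a w a b) v)
    + ∑ a, ∑ d, (W a v a d * W c v d b - W a v d c * W d v a b)

lemma coordConn_mul_frame (H : IsLeviCivitaFrame U N Θ E W) {v : Fin n → ℝ} (hv : v ∈ U)
    (c : Fin n) : ∑ k, E v k c • coordConn Θ W k v = W c v := by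
  simp only [coordConn, Finset.smul_sum, smul_smul]
  rw [Finset.sum_comm]
  simp only [← Finset.sum_smul]
  have h : ∀ d, ∑ k, E v k c * Θ v d k = (1 : Matrix (Fin n) (Fin n) ℝ) d c := by
    intro d
    rw [← H.dual v hv, Matrix.mul_apply]
    exact Finset.sum_congr rfl fun _ _ => mul_comm _ _
  simp [h, Matrix.one_apply, ite_smul]

/-- The second structure equation: the curvature evaluated on two frame vectors `e_p`, `e_c`. The
term with `W c v d p - W p v d c` is `dθᵈ(e_p, e_c)`, by the vanishing of the torsion. -/
lemma curv_frame (H : IsLeviCivitaFrame U N Θ E W) {v : Fin n → ℝ} (hv : v ∈ U)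
    (a b p c : Fin n) :
    ∑ i, ∑ k, E v i p * E v k c * curv (coordConn Θ W) i k v a b
      = frameDeriv E p (fun w => W c w a b) v - frameDeriv E c (fun w => W p w a b) v
        + ∑ d, (W c v d p - W p v d c) * W d v a b
        + (W p v * W c v - W c v * W p v) a b := by
  have hmul : ∀ p c, ∑ i, ∑ k, E v i p * E v k c * (coordConn Θ W i v * coordConn Θ W k v) a b
      = (W p v * W c v) a b := by
    intro p c
    conv_rhs => rw [← H.coordConn_mul_frame hv p, ← H.coordConn_mul_frame hv c]
    rw [Finset.sum_mul_sum]
    simp [Matrix.sum_apply, smul_smul, mul_comm]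
  have hpd : ∀ i k, mpd i (coordConn Θ W k) v a b
      = ∑ d, (pd i (fun w => Θ w d k) v * W d v a b
          + Θ v d k * pd i (fun w => W d w a b) v) := by
    intro i k
    simp only [mpd, Matrix.of_apply, coordConn, Matrix.sum_apply, Matrix.smul_apply, smul_eq_mul]
    rw [pd_sum Finset.univ (F := fun d w => Θ w d k * W d w a b)
      (fun d _ => (H.mDiffAt_coframe hv d k).mul (H.conn_diff d v hv a b))]
    exact Finset.sum_congr rfl fun d _ =>
      pd_mul (H.mDiffAt_coframe hv d k) (H.conn_diff d v hv a b) i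
  have hδ : ∀ d c, ∑ k, Θ v d k * E v k c = (1 : Matrix (Fin n) (Fin n) ℝ) d c := by
    intro d c
    rw [← H.dual v hv, Matrix.mul_apply]
  have hD : ∀ p c, ∑ i, ∑ k, E v i p * E v k c * mpd i (coordConn Θ W k) v a b
      = frameDeriv E p (fun w => W c w a b) v
        + ∑ d, (∑ k, frameDeriv E p (fun w => Θ w d k) v * E v k c) * W d v a b := by
    intro p c
    have h1 : ∑ i, ∑ k, E v i p * E v k c * mpd i (coordConn Θ W k) v a b
        = ∑ d, ∑ k, ∑ i, (E v i p * E v k c * (pd i (fun w => Θ w d k) v * W d v a b)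
          + E v i p * E v k c * (Θ v d k * pd i (fun w => W d w a b) v)) := by
      simp only [hpd, Finset.mul_sum, mul_add]
      rw [Finset.sum_comm]
      calc _ = ∑ k, ∑ d, ∑ i, (E v i p * E v k c * (pd i (fun w => Θ w d k) v * W d v a b)
          + E v i p * E v k c * (Θ v d k * pd i (fun w => W d w a b) v)) :=
            Finset.sum_congr rfl fun k _ => Finset.sum_comm
        _ = _ := Finset.sum_comm
    rw [h1]
    simp only [Finset.sum_add_distrib]
    rw [add_comm]
    congr 1
    · have h2 : ∀ d, ∑ k, ∑ i, E v i p * E v k c * (Θ v d k * pd i (fun w => W d w a b) v)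
          = (1 : Matrix (Fin n) (Fin n) ℝ) d c * frameDeriv E p (fun w => W d w a b) v := by
        intro d
        rw [← hδ, Finset.sum_mul]
        refine Finset.sum_congr rfl fun k _ => ?_
        rw [frameDeriv, dirDeriv, Finset.mul_sum]
        exact Finset.sum_congr rfl fun i _ => by ring
      simp [h2, Matrix.one_apply]
    · refine Finset.sum_congr rfl fun d _ => ?_
      rw [Finset.sum_mul]
      refine Finset.sum_congr rfl fun k _ => ?_
      rw [frameDeriv, dirDeriv, Finset.sum_mul, Finset.sum_mul]
      exact Finset.sum_congr rfl fun i _ => by ring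
  have hsw : ∀ X : Fin n → Fin n → ℝ, ∑ i, ∑ k, E v i p * E v k c * X k i
      = ∑ i, ∑ k, E v i c * E v k p * X i k := by
    intro X
    rw [Finset.sum_comm]
    exact Finset.sum_congr rfl fun i _ => Finset.sum_congr rfl fun k _ => by ring
  simp only [curv, Matrix.add_apply, Matrix.sub_apply, mul_add, mul_sub, Finset.sum_add_distrib,
    Finset.sum_sub_distrib]
  rw [hsw fun k i => mpd k (coordConn Θ W i) v a b, hD, hD, hmul,
    hsw fun k i => (coordConn Θ W k v * coordConn Θ W i v) a b, hmul]
  have ht : ∑ d, (W c v d p - W p v d c) * W d v a b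
      = ∑ d, (∑ k, frameDeriv E p (fun w => Θ w d k) v * E v k c) * W d v a b
        - ∑ d, (∑ k, frameDeriv E c (fun w => Θ w d k) v * E v k p) * W d v a b := by
    rw [← Finset.sum_sub_distrib]
    refine Finset.sum_congr rfl fun d _ => ?_
    rw [← H.torsion v hv d p c, Finset.sum_sub_distrib]
    ring
  rw [ht]
  ring

/-- The coordinate Ricci tensor of `∑ N_ab θᵃ θᵇ`, evaluated on the frame, is given by the
connection coefficients of the frame. -/
theorem ricci_frame (H : IsLeviCivitaFrame U N Θ E W)
    {g : (Fin n → ℝ) → Matrix (Fin n) (Fin n) ℝ}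
    (hg : ∀ v ∈ U, g v = (Θ v).transpose * N * Θ v) {v : Fin n → ℝ} (hv : v ∈ U) (b c : Fin n) :
    ((E v).transpose * ricci g v * E v) b c = frameRicci E W v b c := by
  have h0 : ∀ i k, curv (gauge Θ E W) i k v * E v = E v * curv (coordConn Θ W) i k v := by
    intro i k
    calc _ = (E v * Θ v) * curv (gauge Θ E W) i k v * E v := by rw [H.dual' hv, Matrix.one_mul]
      _ = E v * (Θ v * curv (gauge Θ E W) i k v) * E v := by rw [Matrix.mul_assoc (E v)]
      _ = _ := by
        rw [H.coframe_mul_curv hv, Matrix.mul_assoc, Matrix.mul_assoc, H.dual v hv,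
          Matrix.mul_one]
  have h1 : ((E v).transpose * ricci g v * E v) b c
      = ∑ a, ∑ i, ∑ k, E v i a * E v k c * curv (coordConn Θ W) i k v a b := by
    have h2 : ∀ k, ((E v).transpose * ricci g v) b k
        = ∑ i, ∑ a, E v i a * curv (coordConn Θ W) i k v a b := by
      intro k
      simp only [Matrix.mul_apply (M := (E v).transpose), Matrix.transpose_apply,
        H.ricci_apply hg hv, Finset.mul_sum]
      rw [Finset.sum_comm]
      refine Finset.sum_congr rfl fun i _ => ?_
      have h3 := congrFun (congrFun (h0 i k) i) b
      rw [Matrix.mul_apply, Matrix.mul_apply] at h3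
      rw [← h3]
      exact Finset.sum_congr rfl fun _ _ => mul_comm _ _
    rw [Matrix.mul_apply]
    simp only [h2, Finset.sum_mul]
    calc _ = ∑ i, ∑ k, ∑ a, E v i a * curv (coordConn Θ W) i k v a b * E v k c := Finset.sum_comm
      _ = ∑ i, ∑ a, ∑ k, E v i a * curv (coordConn Θ W) i k v a b * E v k c :=
        Finset.sum_congr rfl fun i _ => Finset.sum_comm
      _ = ∑ a, ∑ i, ∑ k, E v i a * curv (coordConn Θ W) i k v a b * E v k c := Finset.sum_comm
      _ = _ := Finset.sum_congr rfl fun a _ => Finset.sum_congr rfl fun i _ =>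
        Finset.sum_congr rfl fun k _ => by ring
  rw [h1]
  simp only [H.curv_frame hv]
  rw [frameRicci, Finset.sum_add_distrib, Finset.sum_add_distrib, add_assoc]
  congr 1
  simp only [Matrix.sub_apply, Matrix.mul_apply, sub_mul, Finset.sum_sub_distrib]
  -- Two of the four quadratic terms cancel after renaming the summation indices.
  have h4 : ∑ a, ∑ d, W c v d a * W d v a b = ∑ a, ∑ d, W c v a d * W a v d b := Finset.sum_comm
  rw [h4]
  ring

end IsLeviCivitaFrame

/-! ### Functions pulled back to the ambient space -/

/-- A function of `(x, y)`, as a function on the ambient space. -/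
def onXY (φ : (Fin 2 → ℝ) → ℝ) (v : Fin 7 → ℝ) : ℝ := φ (xy (base v))

/-- A function of `(x, y, p)`, as a function on the ambient space. -/
def onXYP (φ : (Fin 3 → ℝ) → ℝ) (v : Fin 7 → ℝ) : ℝ := φ (xyp (base v))

/-- A function of `(x, y, p, ϱ)`, as a function on the ambient space. -/
def onXYPR (φ : (Fin 4 → ℝ) → ℝ) (v : Fin 7 → ℝ) : ℝ := φ (xypr (base v) (rhoCoord v))

lemma hasFDerivAt_comp_select {m n : ℕ} (s : Fin m → Fin n) {φ : (Fin m → ℝ) → ℝ} {v : Fin n → ℝ}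
    (hφ : DifferentiableAt ℝ φ fun j => v (s j)) :
    HasFDerivAt (fun w : Fin n → ℝ => φ fun j => w (s j))
      ((fderiv ℝ φ fun j => v (s j)).comp
        (ContinuousLinearMap.pi fun j => ContinuousLinearMap.proj (s j))) v :=
  HasFDerivAt.comp v hφ.hasFDerivAt
    (hasFDerivAt_pi.2 fun j =>
      (ContinuousLinearMap.proj (R := ℝ) (φ := fun _ : Fin n => ℝ) (s j)).hasFDerivAt)

/-- The partial derivatives of `w ↦ φ (w (s 1), …, w (s m))`, for an arbitrary selection `s` of
coordinates. -/
lemma pd_comp_select {m n : ℕ} (s : Fin m → Fin n) {φ : (Fin m → ℝ) → ℝ} {v : Fin n → ℝ}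
    (hφ : DifferentiableAt ℝ φ fun j => v (s j)) (i : Fin n) :
    pd i (fun w : Fin n → ℝ => φ fun j => w (s j)) v
      = ∑ j, if s j = i then pd j φ (fun j => v (s j)) else 0 := by
  rw [pd, (hasFDerivAt_comp_select s hφ).fderiv, ContinuousLinearMap.comp_apply]
  have h : (ContinuousLinearMap.pi fun j => ContinuousLinearMap.proj (R := ℝ)
      (φ := fun _ : Fin n => ℝ) (s j)) (Pi.single i 1)
      = ∑ j, if s j = i then (Pi.single j 1 : Fin m → ℝ) else 0 := by
    ext k
    rw [Finset.sum_apply, Finset.sum_eq_single k]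
    · by_cases hk : s k = i <;> simp [hk]
    · intro j _ hj
      by_cases hs : s j = i <;> simp [hs, hj.symm]
    · simp
  rw [h, map_sum]
  exact Finset.sum_congr rfl fun j _ => by split_ifs <;> simp [pd]

lemma onXY_eq (φ : (Fin 2 → ℝ) → ℝ) :
    onXY φ = fun w => φ fun j => w ((![1, 2] : Fin 2 → Fin 7) j) := by
  funext w
  refine congrArg φ (funext fun j => ?_)
  fin_cases j <;> rfl

lemma onXYP_eq (φ : (Fin 3 → ℝ) → ℝ) :
    onXYP φ = fun w => φ fun j => w ((![1, 2, 3] : Fin 3 → Fin 7) j) := by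
  funext w
  refine congrArg φ (funext fun j => ?_)
  fin_cases j <;> rfl

lemma onXYPR_eq (φ : (Fin 4 → ℝ) → ℝ) :
    onXYPR φ = fun w => φ fun j => w ((![1, 2, 3, 6] : Fin 4 → Fin 7) j) := by
  funext w
  refine congrArg φ (funext fun j => ?_)
  fin_cases j <;> rfl

lemma differentiableAt_onXY {φ : (Fin 2 → ℝ) → ℝ} {v : Fin 7 → ℝ}
    (hφ : DifferentiableAt ℝ φ (xy (base v))) : DifferentiableAt ℝ (onXY φ) v := by
  rw [onXY_eq]
  refine (hasFDerivAt_comp_select _ ?_).differentiableAt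
  convert hφ using 1
  funext j; fin_cases j <;> rfl

lemma differentiableAt_onXYP {φ : (Fin 3 → ℝ) → ℝ} {v : Fin 7 → ℝ}
    (hφ : DifferentiableAt ℝ φ (xyp (base v))) : DifferentiableAt ℝ (onXYP φ) v := by
  rw [onXYP_eq]
  refine (hasFDerivAt_comp_select _ ?_).differentiableAt
  convert hφ using 1
  funext j; fin_cases j <;> rfl

lemma differentiableAt_onXYPR {φ : (Fin 4 → ℝ) → ℝ} {v : Fin 7 → ℝ}
    (hφ : DifferentiableAt ℝ φ (xypr (base v) (rhoCoord v))) :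
    DifferentiableAt ℝ (onXYPR φ) v := by
  rw [onXYPR_eq]
  refine (hasFDerivAt_comp_select _ ?_).differentiableAt
  convert hφ using 1
  funext j; fin_cases j <;> rfl

lemma pd_onXY {φ : (Fin 2 → ℝ) → ℝ} {v : Fin 7 → ℝ}
    (hφ : DifferentiableAt ℝ φ (xy (base v))) (i : Fin 7) :
    pd i (onXY φ) v = (![0, onXY (pd 0 φ) v, onXY (pd 1 φ) v, 0, 0, 0, 0] : Fin 7 → ℝ) i := by
  have e : (fun j => v ((![1, 2] : Fin 2 → Fin 7) j)) = xy (base v) := by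
    funext j; fin_cases j <;> rfl
  rw [onXY_eq, pd_comp_select _ (by rwa [e]), e]
  fin_cases i <;> simp [Fin.sum_univ_succ, onXY]

lemma pd_onXYP {φ : (Fin 3 → ℝ) → ℝ} {v : Fin 7 → ℝ}
    (hφ : DifferentiableAt ℝ φ (xyp (base v))) (i : Fin 7) :
    pd i (onXYP φ) v = (![0, onXYP (pd 0 φ) v, onXYP (pd 1 φ) v, onXYP (pd 2 φ) v, 0, 0, 0] :
      Fin 7 → ℝ) i := by
  have e : (fun j => v ((![1, 2, 3] : Fin 3 → Fin 7) j)) = xyp (base v) := by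
    funext j; fin_cases j <;> rfl
  rw [onXYP_eq, pd_comp_select _ (by rwa [e]), e]
  fin_cases i <;> simp [Fin.sum_univ_succ, onXYP]

lemma pd_onXYPR {φ : (Fin 4 → ℝ) → ℝ} {v : Fin 7 → ℝ}
    (hφ : DifferentiableAt ℝ φ (xypr (base v) (rhoCoord v))) (i : Fin 7) :
    pd i (onXYPR φ) v = (![0, onXYPR (pd 0 φ) v, onXYPR (pd 1 φ) v, onXYPR (pd 2 φ) v, 0, 0,
      onXYPR (pd 3 φ) v] : Fin 7 → ℝ) i := by
  have e : (fun j => v ((![1, 2, 3, 6] : Fin 4 → Fin 7) j)) = xypr (base v) (rhoCoord v) := by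
    funext j; fin_cases j <;> rfl
  rw [onXYPR_eq, pd_comp_select _ (by rwa [e]), e]
  fin_cases i <;> simp [Fin.sum_univ_succ, onXYPR]

section dirDeriv

variable {X v : Fin 7 → ℝ}

lemma dirDeriv_onXY {φ : (Fin 2 → ℝ) → ℝ} (hφ : DifferentiableAt ℝ φ (xy (base v))) :
    dirDeriv X (onXY φ) v = X 1 * onXY (pd 0 φ) v + X 2 * onXY (pd 1 φ) v := by
  simp [dirDeriv, pd_onXY hφ, Fin.sum_univ_seven]

lemma dirDeriv_onXYP {φ : (Fin 3 → ℝ) → ℝ} (hφ : DifferentiableAt ℝ φ (xyp (base v))) :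
    dirDeriv X (onXYP φ) v
      = X 1 * onXYP (pd 0 φ) v + X 2 * onXYP (pd 1 φ) v + X 3 * onXYP (pd 2 φ) v := by
  simp [dirDeriv, pd_onXYP hφ, Fin.sum_univ_seven]

lemma dirDeriv_onXYPR {φ : (Fin 4 → ℝ) → ℝ}
    (hφ : DifferentiableAt ℝ φ (xypr (base v) (rhoCoord v))) :
    dirDeriv X (onXYPR φ) v = X 1 * onXYPR (pd 0 φ) v + X 2 * onXYPR (pd 1 φ) v
      + X 3 * onXYPR (pd 2 φ) v + X 6 * onXYPR (pd 3 φ) v := by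
  simp [dirDeriv, pd_onXYPR hφ, Fin.sum_univ_seven]

end dirDeriv

lemma isOpen_image_xy {M : Set (Fin 5 → ℝ)} (hM : IsOpen M) : IsOpen (xy '' M) := by
  let T : (Fin 5 → ℝ) →ₗ[ℝ] (Fin 2 → ℝ) := LinearMap.pi ![LinearMap.proj 0, LinearMap.proj 1]
  have hT : ⇑T = xy := by
    funext u j; fin_cases j <;> rfl
  have hs : Function.Surjective T := fun w => ⟨![w 0, w 1, 0, 0, 0], by
    rw [hT]; funext j; fin_cases j <;> rfl⟩
  exact hT ▸ T.isOpenMap_of_finiteDimensional hs M hM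

lemma isOpen_image_xyp {M : Set (Fin 5 → ℝ)} (hM : IsOpen M) : IsOpen (xyp '' M) := by
  let T : (Fin 5 → ℝ) →ₗ[ℝ] (Fin 3 → ℝ) :=
    LinearMap.pi ![LinearMap.proj 0, LinearMap.proj 1, LinearMap.proj 2]
  have hT : ⇑T = xyp := by
    funext u j; fin_cases j <;> rfl
  have hs : Function.Surjective T := fun w => ⟨![w 0, w 1, w 2, 0, 0], by
    rw [hT]; funext j; fin_cases j <;> rfl⟩
  exact hT ▸ T.isOpenMap_of_finiteDimensional hs M hM

lemma isOpen_image2_xypr {M : Set (Fin 5 → ℝ)} (hM : IsOpen M) (ε : ℝ) :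
    IsOpen (Set.image2 xypr M (Set.Ioo (-ε) ε)) := by
  let T : (Fin 5 → ℝ) × ℝ →ₗ[ℝ] (Fin 4 → ℝ) :=
    LinearMap.pi ![LinearMap.proj 0 ∘ₗ LinearMap.fst ℝ _ _, LinearMap.proj 1 ∘ₗ LinearMap.fst ℝ _ _,
      LinearMap.proj 2 ∘ₗ LinearMap.fst ℝ _ _, LinearMap.snd ℝ _ _]
  have hT : ⇑T = fun q => xypr q.1 q.2 := by
    funext u j; fin_cases j <;> rfl
  have hs : Function.Surjective T := fun w => ⟨(![w 0, w 1, w 2, 0, 0], w 3), by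
    rw [hT]; funext j; fin_cases j <;> rfl⟩
  rw [← Set.image_prod, ← hT]
  exact T.isOpenMap_of_finiteDimensional hs _ (hM.prod isOpen_Ioo)

/-! ### Smoothness of the data -/

/-- The smoothness assumptions on the data `f`, `h`, `A`, `B`, `C`. -/
structure IsSmoothData (M : Set (Fin 5 → ℝ)) (ε : ℝ) (f : (Fin 3 → ℝ) → ℝ) (h : (Fin 2 → ℝ) → ℝ)
    (A B C : (Fin 4 → ℝ) → ℝ) : Prop where
  isOpen : IsOpen M
  f : ContDiffOn ℝ ∞ f (xyp '' M)
  h : ContDiffOn ℝ ∞ h (xy '' M)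
  A : ContDiffOn ℝ ∞ A (Set.image2 xypr M (Set.Ioo (-ε) ε))
  B : ContDiffOn ℝ ∞ B (Set.image2 xypr M (Set.Ioo (-ε) ε))
  C : ContDiffOn ℝ ∞ C (Set.image2 xypr M (Set.Ioo (-ε) ε))

section Smooth

variable {M : Set (Fin 5 → ℝ)} {ε : ℝ} {v : Fin 7 → ℝ}

lemma isOpen_ambientSpace (hM : IsOpen M) : IsOpen (ambientSpace M ε) := by
  refine (isOpen_lt continuous_const (continuous_apply 0)).inter
    ((hM.preimage ?_).inter (isOpen_Ioo.preimage (continuous_apply _)))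
  exact continuous_pi fun i => continuous_apply _

lemma diffAt_xy (hM : IsOpen M) (hv : v ∈ ambientSpace M ε) {φ : (Fin 2 → ℝ) → ℝ}
    (hφ : ContDiffOn ℝ ∞ φ (xy '' M)) :
    DifferentiableAt ℝ φ (xy (base v)) :=
  differentiableAt_of_contDiffOn (isOpen_image_xy hM) hφ ⟨_, hv.2.1, rfl⟩

lemma diffAt_xyp (hM : IsOpen M) (hv : v ∈ ambientSpace M ε) {φ : (Fin 3 → ℝ) → ℝ}
    (hφ : ContDiffOn ℝ ∞ φ (xyp '' M)) :
    DifferentiableAt ℝ φ (xyp (base v)) :=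
  differentiableAt_of_contDiffOn (isOpen_image_xyp hM) hφ ⟨_, hv.2.1, rfl⟩

lemma diffAt_xypr (hM : IsOpen M) (hv : v ∈ ambientSpace M ε)
    {φ : (Fin 4 → ℝ) → ℝ}
    (hφ : ContDiffOn ℝ ∞ φ (Set.image2 xypr M (Set.Ioo (-ε) ε))) :
    DifferentiableAt ℝ φ (xypr (base v) (rhoCoord v)) :=
  differentiableAt_of_contDiffOn (isOpen_image2_xypr hM ε) hφ ⟨_, hv.2.1, _, hv.2.2, rfl⟩

lemma contDiffOn_onXY {φ : (Fin 2 → ℝ) → ℝ} (hφ : ContDiffOn ℝ ∞ φ (xy '' M)) :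
    ContDiffOn ℝ ∞ (onXY φ) (ambientSpace M ε) := by
  refine hφ.comp (ContDiff.contDiffOn ?_) fun v hv => ⟨_, hv.2.1, rfl⟩
  exact contDiff_pi.2 fun j => by fin_cases j <;> exact contDiff_apply ℝ ℝ _

lemma contDiffOn_onXYP {φ : (Fin 3 → ℝ) → ℝ} (hφ : ContDiffOn ℝ ∞ φ (xyp '' M)) :
    ContDiffOn ℝ ∞ (onXYP φ) (ambientSpace M ε) := by
  refine hφ.comp (ContDiff.contDiffOn ?_) fun v hv => ⟨_, hv.2.1, rfl⟩
  exact contDiff_pi.2 fun j => by fin_cases j <;> exact contDiff_apply ℝ ℝ _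

lemma contDiffOn_onXYPR {φ : (Fin 4 → ℝ) → ℝ}
    (hφ : ContDiffOn ℝ ∞ φ (Set.image2 xypr M (Set.Ioo (-ε) ε))) :
    ContDiffOn ℝ ∞ (onXYPR φ) (ambientSpace M ε) := by
  refine hφ.comp (ContDiff.contDiffOn ?_) fun v hv => ⟨_, hv.2.1, _, hv.2.2, rfl⟩
  exact contDiff_pi.2 fun j => by fin_cases j <;> exact contDiff_apply ℝ ℝ _

variable {f : (Fin 3 → ℝ) → ℝ} {h : (Fin 2 → ℝ) → ℝ} {A B C : (Fin 4 → ℝ) → ℝ}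

/-- Smoothness of the iterated partial derivatives `∂_{i₁} ⋯ ∂_{iₖ} φ`. -/
lemma contDiffOn_foldr_pd {n : ℕ} {U : Set (Fin n → ℝ)} (hU : IsOpen U) {φ : (Fin n → ℝ) → ℝ}
    (hφ : ContDiffOn ℝ ∞ φ U) : ∀ l : List (Fin n), ContDiffOn ℝ ∞ (l.foldr pd φ) U
  | [] => hφ
  | i :: l => contDiffOn_pd hU (contDiffOn_foldr_pd hU hφ l) i

namespace IsSmoothData

lemma diff_f (D : IsSmoothData M ε f h A B C) (hv : v ∈ ambientSpace M ε)
    (l : List (Fin 3)) :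
    DifferentiableAt ℝ (l.foldr pd f) (xyp (base v)) :=
  diffAt_xyp D.isOpen hv (contDiffOn_foldr_pd (isOpen_image_xyp D.isOpen) D.f l)

lemma diff_h (D : IsSmoothData M ε f h A B C) (hv : v ∈ ambientSpace M ε)
    (l : List (Fin 2)) :
    DifferentiableAt ℝ (l.foldr pd h) (xy (base v)) :=
  diffAt_xy D.isOpen hv (contDiffOn_foldr_pd (isOpen_image_xy D.isOpen) D.h l)

lemma diff_A (D : IsSmoothData M ε f h A B C) (hv : v ∈ ambientSpace M ε)
    (l : List (Fin 4)) :
    DifferentiableAt ℝ (l.foldr pd A) (xypr (base v) (rhoCoord v)) :=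
  diffAt_xypr D.isOpen hv (contDiffOn_foldr_pd (isOpen_image2_xypr D.isOpen ε) D.A l)

lemma diff_B (D : IsSmoothData M ε f h A B C) (hv : v ∈ ambientSpace M ε)
    (l : List (Fin 4)) :
    DifferentiableAt ℝ (l.foldr pd B) (xypr (base v) (rhoCoord v)) :=
  diffAt_xypr D.isOpen hv (contDiffOn_foldr_pd (isOpen_image2_xypr D.isOpen ε) D.B l)

lemma diff_C (D : IsSmoothData M ε f h A B C) (hv : v ∈ ambientSpace M ε)
    (l : List (Fin 4)) :
    DifferentiableAt ℝ (l.foldr pd C) (xypr (base v) (rhoCoord v)) :=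
  diffAt_xypr D.isOpen hv (contDiffOn_foldr_pd (isOpen_image2_xypr D.isOpen ε) D.C l)

end IsSmoothData

end Smooth

/-! ### The adapted coframe and its Levi-Civita connection -/

section Frame

variable (f : (Fin 3 → ℝ) → ℝ) (h : (Fin 2 → ℝ) → ℝ) (A B C : (Fin 4 → ℝ) → ℝ)

/-- The coefficient of `θ¹` in `θ⁵ + ½ A θ¹`. -/
def kappa (v : Fin 7 → ℝ) : ℝ :=
  1 / 10 * (9 * onXYP (pd 2 (pd 2 f)) v + 4 * onXY h v ^ 2
    - 6 * (v 3 * onXY (pd 1 h) v + onXY (pd 0 h) v)) + 1 / 2 * onXYPR A v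

/-- The coframe `dt, t θ¹, t (θ² - ½ C θ⁴), t θ³ / (2√2), t θ⁴, t (θ⁵ + ½ A θ¹ + B θ⁴), d(ϱ t)`. The
form `θ³` is rescaled to keep `√2` out of the computations. -/
def coframe (v : Fin 7 → ℝ) : Matrix (Fin 7) (Fin 7) ℝ :=
  !![1, 0, 0, 0, 0, 0, 0;
     0, -(v 0 * v 3), v 0, 0, 0, 0, 0;
     0, v 0 * (v 4 * v 4 - onXYP f v - onXY h v * v 5 - 3 / 2 * onXYPR C v), 0, -2 * (v 0 * v 4), 0,
       v 0, 0;
     0, -(v 0 * v 4), 0, v 0, 0, 0, 0;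
     0, 3 * v 0, 0, 0, 0, 0, 0;
     0, v 0 * (4 * (onXY h v * v 4) + 3 * onXYP (pd 2 f) v - kappa f h A v * v 3
       + 3 * onXYPR B v), v 0 * kappa f h A v, 2 * (v 0 * onXY h v), -6 * v 0, 0, 0;
     v 6, 0, 0, 0, 0, 0, v 0]

/-- The vector fields `X_b = t e_b`, where `e_b` is the frame dual to `coframe`; the row `b` holds
the components of `X_b`. -/
def scaledFrame (v : Fin 7 → ℝ) : Matrix (Fin 7) (Fin 7) ℝ :=
  !![v 0, 0, 0, 0, 0, 0, -v 6;
     0, 0, 1, 0, 1 / 6 * kappa f h A v, 0, 0;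
     0, 0, 0, 0, 0, 1, 0;
     0, 0, 0, 1, 1 / 3 * onXY h v, 2 * v 4, 0;
     0, 1 / 3, 1 / 3 * v 3, 1 / 3 * v 4,
       1 / 3 * (onXY h v * v 4) + 1 / 6 * onXYP (pd 2 f) v + 1 / 6 * onXYPR B v,
       1 / 3 * (v 4 * v 4 + onXYP f v + onXY h v * v 5) + 1 / 2 * onXYPR C v, 0;
     0, 0, 0, 0, -(1 / 6), 0, 0;
     0, 0, 0, 0, 0, 0, 1]

/-- The frame `e_b` dual to `coframe`, as the columns of a matrix. -/
def frame (v : Fin 7 → ℝ) : Matrix (Fin 7) (Fin 7) ℝ :=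
  (v 0)⁻¹ • (scaledFrame f h A B C v).transpose

/-- The Gram matrix of the ansatz in the frame dual to `coframe`. -/
def gram : Matrix (Fin 7) (Fin 7) ℝ :=
  !![0, 0, 0, 0, 0, 0, 1;
     0, 0, 0, 0, 0, 1, 0;
     0, 0, 0, 0, -1, 0, 0;
     0, 0, 0, 8, 0, 0, 0;
     0, 0, -1, 0, 0, 0, 0;
     0, 1, 0, 0, 0, 0, 0;
     1, 0, 0, 0, 0, 0, 0]

/-- The endomorphism `gram⁻¹ ω`, where `ω` is the skew form with the entries `wᵃᵇ = ω_ab` below the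
diagonal; the seven entries that vanish for the connection of the ansatz are left out. -/
def skewEnd (w10 w20 w30 w40 w50 w31 w41 w42 w43 w51 w53 w54 w61 w64 : ℝ) :
    Matrix (Fin 7) (Fin 7) ℝ :=
  !![0, w61, 0, 0, w64, 0, 0;
     w50, w51, 0, w53, w54, 0, 0;
     -w40, -w41, -w42, -w43, 0, w54, w64;
     1 / 8 * w30, 1 / 8 * w31, 0, 0, -(1 / 8 * w43), -(1 / 8 * w53), 0;
     -w20, 0, 0, 0, w42, 0, 0;
     w10, 0, 0, -w31, -w41, -w51, -w61;
     0, -w10, -w20, -w30, -w40, -w50, 0]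

lemma skewEnd_skew (w10 w20 w30 w40 w50 w31 w41 w42 w43 w51 w53 w54 w61 w64 : ℝ) :
    gram * skewEnd w10 w20 w30 w40 w50 w31 w41 w42 w43 w51 w53 w54 w61 w64
      + (gram * skewEnd w10 w20 w30 w40 w50 w31 w41 w42 w43 w51 w53 w54 w61 w64).transpose
      = 0 := by
  rw [gram, skewEnd]
  simp only [← Matrix.ext_iff, Fin.forall_fin_succ]
  simp

/-- The connection coefficient `⟨∇_{X₁} e₁, e₃⟩`. -/
def c311 (v : Fin 7 → ℝ) : ℝ :=
  -(1 / 2) * onXYPR (pd 2 A) v - 9 / 10 * onXYP (pd 2 (pd 2 (pd 2 f))) v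
    + 13 / 5 * onXY (pd 1 h) v

/-- The connection coefficient `⟨∇_{X₄} e₁, e₃⟩`. -/
def c314 (v : Fin 7 → ℝ) : ℝ :=
  1 / 18 * onXYPR A v - 1 / 2 * onXYPR (pd 2 B) v - 2 / 5 * onXYP (pd 2 (pd 2 f)) v
    - 8 / 45 * (onXY h v * onXY h v) + 4 / 15 * (onXY (pd 0 h) v + onXY (pd 1 h) v * v 3)

/-- The part of `⟨∇_{X₁} e₁, e₄⟩` that does not depend on `q`. Only its independence of `t`, `q` and
`z` enters the Ricci tensor. -/
def c411base (v : Fin 7 → ℝ) : ℝ :=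
  1 / 9 * (onXYPR A v * onXY h v) - 1 / 6 * onXYPR (pd 0 A) v - 1 / 6 * (onXYPR (pd 1 A) v * v 3)
    + onXYPR (pd 1 B) v + 1 / 5 * (onXYP (pd 2 (pd 2 f)) v * onXY h v)
    - 3 / 10 * onXYP (pd 0 (pd 2 (pd 2 f))) v - 3 / 10 * (onXYP (pd 1 (pd 2 (pd 2 f))) v * v 3)
    + onXYP (pd 1 (pd 2 f)) v - 2 / 5 * (onXY h v * onXY (pd 0 h) v)
    - 2 / 5 * (onXY h v * onXY (pd 1 h) v * v 3) + 4 / 45 * (onXY h v * onXY h v * onXY h v)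
    + 1 / 5 * onXY (pd 0 (pd 0 h)) v + 2 / 5 * (onXY (pd 0 (pd 1 h)) v * v 3)
    + 1 / 5 * (onXY (pd 1 (pd 1 h)) v * (v 3 * v 3))

/-- The connection coefficient `⟨∇_{X₁} e₁, e₄⟩`. -/
def c411 (v : Fin 7 → ℝ) : ℝ :=
  c411base f h A B v + (-(1 / 6) * onXYPR (pd 2 A) v - 3 / 10 * onXYP (pd 2 (pd 2 (pd 2 f))) v
    + 11 / 5 * onXY (pd 1 h) v) * v 4

/-- The connection coefficient `⟨∇_{X₃} e₁, e₄⟩`. -/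
def c413 (v : Fin 7 → ℝ) : ℝ :=
  -(1 / 9) * onXYPR A v + 1 / 2 * onXYPR (pd 2 B) v + 3 / 10 * onXYP (pd 2 (pd 2 f)) v
    + 2 / 15 * (onXY h v * onXY h v) - 1 / 5 * (onXY (pd 0 h) v + onXY (pd 1 h) v * v 3)

/-- The connection coefficient `⟨∇_{X₄} e₁, e₄⟩`. -/
def c414 (v : Fin 7 → ℝ) : ℝ :=
  1 / 2 * onXYPR (pd 1 C) v + 1 / 3 * onXYP (pd 1 f) v + 1 / 3 * (onXY (pd 1 h) v * v 5)

/-- The connection coefficient `⟨∇_{X₁} e₃, e₄⟩`. -/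
def c431 (v : Fin 7 → ℝ) : ℝ := -(5 / 18) * onXYPR A v + 1 / 2 * onXYPR (pd 2 B) v

/-- The connection coefficient `⟨∇_{X₄} e₃, e₄⟩`. -/
def c434 (v : Fin 7 → ℝ) : ℝ := -(1 / 3) * onXYPR B v + 1 / 2 * onXYPR (pd 2 C) v

/-- `- ½ ϱ ∂U/∂ϱ` for `U = A, B, C`. -/
def rhoDer (U : (Fin 4 → ℝ) → ℝ) (v : Fin 7 → ℝ) : ℝ := -(1 / 2) * (v 6 * onXYPR (pd 3 U) v)

/-- The matrices of `∇_{X_c} = t ∇_{e_c}` in the frame dual to `coframe`. -/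
def scaledConn (c : Fin 7) (v : Fin 7 → ℝ) : Matrix (Fin 7) (Fin 7) ℝ :=
  ![skewEnd 0 0 0 0 0 0 (rhoDer B v) 0 0 0 0 0 0 0,
    skewEnd (rhoDer A v) 0 0 (rhoDer B v) 1 (c311 f h A v) (c411 f h A B v) 0 (c431 A B v) 0 0
      (1 / 9 * onXY h v) (-(1 / 2) * onXYPR (pd 3 A) v) (-(1 / 2) * onXYPR (pd 3 B) v),
    skewEnd 0 0 0 (-1) 0 0 0 0 0 0 0 0 0 0,
    skewEnd 0 0 8 0 0 0 (c413 f h A B v) 0 (-(8 / 9) * onXY h v) 0 0 (1 / 9) 0 0,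
    skewEnd (rhoDer B v) (-1) 0 (rhoDer C v) 0 (c314 f h A B v) (c414 f h C v) (1 / 3 * onXY h v)
      (c434 B C v) (1 / 9 * onXY h v) (-(2 / 9)) 0 (-(1 / 2) * onXYPR (pd 3 B) v)
      (-(1 / 2) * onXYPR (pd 3 C) v),
    skewEnd 1 0 0 0 0 0 (-(1 / 9) * onXY h v) 0 (2 / 9) 0 0 0 0 0,
    skewEnd 0 0 0 0 0 0 (1 / 2 * onXYPR (pd 3 B) v) 0 0 0 0 0 0 0] c

end Frame

/-! ### Smoothness and duality of the coframe -/

section Smoothness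

variable {M : Set (Fin 5 → ℝ)} {ε : ℝ} {f : (Fin 3 → ℝ) → ℝ} {h : (Fin 2 → ℝ) → ℝ}
  {A B C : (Fin 4 → ℝ) → ℝ}

lemma contDiffOn_coord (M : Set (Fin 5 → ℝ)) (ε : ℝ) (i : Fin 7) :
    ContDiffOn ℝ ∞ (fun v : Fin 7 → ℝ => v i) (ambientSpace M ε) :=
  (contDiff_apply ℝ ℝ i).contDiffOn

lemma contDiffOn_kappa (D : IsSmoothData M ε f h A B C) :
    ContDiffOn ℝ ∞ (kappa f h A) (ambientSpace M ε) := by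
  have h1 := contDiffOn_pd (isOpen_image_xyp D.isOpen) D.f 2
  have h2 := contDiffOn_onXYP (ε := ε) (contDiffOn_pd (isOpen_image_xyp D.isOpen) h1 2)
  have h3 := contDiffOn_onXY (ε := ε) D.h
  have h4 := contDiffOn_onXY (ε := ε) (contDiffOn_pd (isOpen_image_xy D.isOpen) D.h 0)
  have h5 := contDiffOn_onXY (ε := ε) (contDiffOn_pd (isOpen_image_xy D.isOpen) D.h 1)
  have h6 := contDiffOn_onXYPR D.A
  have h7 := contDiffOn_coord M ε 3
  unfold kappa
  fun_prop

lemma contDiffOn_coframe (D : IsSmoothData M ε f h A B C) (a k : Fin 7) :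
    ContDiffOn ℝ ∞ (fun v => coframe f h A B C v a k) (ambientSpace M ε) := by
  have h1 := contDiffOn_onXYP (ε := ε) D.f
  have h2 := contDiffOn_onXYP (ε := ε) (contDiffOn_pd (isOpen_image_xyp D.isOpen) D.f 2)
  have h3 := contDiffOn_onXY (ε := ε) D.h
  have h4 := contDiffOn_onXYPR D.B
  have h5 := contDiffOn_onXYPR D.C
  have h6 := contDiffOn_kappa D
  have h7 := contDiffOn_coord M ε
  revert a k
  simp only [coframe, Fin.forall_fin_succ, Matrix.of_apply, Matrix.cons_val_zero,
    Matrix.cons_val_succ, IsEmpty.forall_iff, and_true]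
  and_intros <;> fun_prop

lemma differentiableAt_kappa (D : IsSmoothData M ε f h A B C) {v : Fin 7 → ℝ}
    (hv : v ∈ ambientSpace M ε) : DifferentiableAt ℝ (kappa f h A) v :=
  differentiableAt_of_contDiffOn (isOpen_ambientSpace D.isOpen) (contDiffOn_kappa D) hv

lemma mDiffAt_frame (D : IsSmoothData M ε f h A B C) {v : Fin 7 → ℝ}
    (hv : v ∈ ambientSpace M ε) : MDiffAt (frame f h A B C) v := by
  have h1 := differentiableAt_onXYP (diffAt_xyp D.isOpen hv D.f)
  have h2 := differentiableAt_onXYP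
    (diffAt_xyp D.isOpen hv (contDiffOn_pd (isOpen_image_xyp D.isOpen) D.f 2))
  have h3 := differentiableAt_onXY (diffAt_xy D.isOpen hv D.h)
  have h4 := differentiableAt_onXYPR (diffAt_xypr D.isOpen hv D.B)
  have h5 := differentiableAt_onXYPR (diffAt_xypr D.isOpen hv D.C)
  have h6 := differentiableAt_kappa D hv
  have ht : DifferentiableAt ℝ (fun w : Fin 7 → ℝ => (w 0)⁻¹) v :=
    (differentiableAt_apply 0 v).inv hv.1.ne'
  have hX : ∀ b i, DifferentiableAt ℝ (fun w => scaledFrame f h A B C w b i) v := by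
    simp only [scaledFrame, Fin.forall_fin_succ, Matrix.of_apply, Matrix.cons_val_zero,
      Matrix.cons_val_succ, IsEmpty.forall_iff, and_true]
    and_intros <;> fun_prop
  intro i b
  exact ht.mul (hX b i)

end Smoothness

section Frame
variable {f : (Fin 3 → ℝ) → ℝ} {h : (Fin 2 → ℝ) → ℝ} {A B C : (Fin 4 → ℝ) → ℝ}

lemma coframe_mul_frame {v : Fin 7 → ℝ} (hv : v 0 ≠ 0) :
    coframe f h A B C v * frame f h A B C v = 1 := by
  rw [frame, Matrix.mul_smul, inv_smul_eq_iff₀ hv]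
  rw [coframe, scaledFrame]
  simp only [← Matrix.ext_iff, Fin.forall_fin_succ, Matrix.mul_apply, Fin.sum_univ_succ,
    Matrix.transpose_apply, Matrix.of_apply, Matrix.cons_val_zero, Matrix.cons_val_succ,
    IsEmpty.forall_iff, and_true, Finset.univ_eq_empty, Finset.sum_empty, Matrix.smul_apply,
    Matrix.one_apply]
  simp
  and_intros <;> ring

/-- `e_b = t⁻¹ X_b` as differential operators. -/
lemma frameDeriv_frame (b : Fin 7) (F : (Fin 7 → ℝ) → ℝ) (v : Fin 7 → ℝ) :
    frameDeriv (frame f h A B C) b F v = (v 0)⁻¹ * dirDeriv (scaledFrame f h A B C v b) F v := by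
  simp [frameDeriv, dirDeriv, frame, Finset.mul_sum, mul_assoc]

end Frame

/-! ### The first structure equation -/

section Torsion

variable {M : Set (Fin 5 → ℝ)} {ε : ℝ} {f : (Fin 3 → ℝ) → ℝ} {h : (Fin 2 → ℝ) → ℝ}
  {A B C : (Fin 4 → ℝ) → ℝ}

lemma dirDeriv_kappa (D : IsSmoothData M ε f h A B C) {v : Fin 7 → ℝ}
    (hv : v ∈ ambientSpace M ε) (X : Fin 7 → ℝ) : dirDeriv X (kappa f h A) v = 
    1 / 10 * (9 * (X 1 * onXYP (pd 0 (pd 2 (pd 2 f))) v + X 2 * onXYP (pd 1 (pd 2 (pd 2 f))) v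
      + X 3 * onXYP (pd 2 (pd 2 (pd 2 f))) v)
    + 8 * onXY h v * (X 1 * onXY (pd 0 h) v + X 2 * onXY (pd 1 h) v)
    - 6 * (X 3 * onXY (pd 1 h) v
      + v 3 * (X 1 * onXY (pd 0 (pd 1 h)) v + X 2 * onXY (pd 1 (pd 1 h)) v)
      + X 1 * onXY (pd 0 (pd 0 h)) v + X 2 * onXY (pd 0 (pd 1 h)) v))
    + 1 / 2 * (X 1 * onXYPR (pd 0 A) v + X 2 * onXYPR (pd 1 A) v + X 3 * onXYPR (pd 2 A) v
      + X 6 * onXYPR (pd 3 A) v) := by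
  have s1 := contDiffOn_pd (isOpen_image_xyp D.isOpen) D.f 2
  have d1 := diffAt_xyp D.isOpen hv (contDiffOn_pd (isOpen_image_xyp D.isOpen) s1 2)
  have d2 := diffAt_xy D.isOpen hv D.h
  have d3 := diffAt_xy D.isOpen hv (contDiffOn_pd (isOpen_image_xy D.isOpen) D.h 0)
  have d4 := diffAt_xy D.isOpen hv (contDiffOn_pd (isOpen_image_xy D.isOpen) D.h 1)
  have d5 := diffAt_xypr D.isOpen hv D.A
  have e1 := differentiableAt_onXYP d1
  have e2 := differentiableAt_onXY d2
  have e3 := differentiableAt_onXY d3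
  have e4 := differentiableAt_onXY d4
  have e5 := differentiableAt_onXYPR d5
  have hc : onXY (pd 1 (pd 0 h)) v = onXY (pd 0 (pd 1 h)) v :=
    pd_comm (isOpen_image_xy D.isOpen) D.h ⟨_, hv.2.1, rfl⟩ 1 0
  unfold kappa
  simp (disch := fun_prop) only [dirDeriv_add, dirDeriv_sub, dirDeriv_mul, dirDeriv_const,
    dirDeriv_coord, pow_two, dirDeriv_onXYP d1, dirDeriv_onXY d2, dirDeriv_onXY d3,
    dirDeriv_onXY d4, dirDeriv_onXYPR d5, hc]
  ring

/-- The derivatives of the components of `coframe` in the direction `X`. -/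
def coframeDeriv (f : (Fin 3 → ℝ) → ℝ) (h : (Fin 2 → ℝ) → ℝ) (A B C : (Fin 4 → ℝ) → ℝ)
    (X v : Fin 7 → ℝ) : Matrix (Fin 7) (Fin 7) ℝ :=
  !![0, 0, 0, 0, 0, 0, 0;
     0, -(X 0 * v 3 + v 0 * X 3), X 0, 0, 0, 0, 0;
     0, X 0 * (v 4 * v 4 - onXYP f v - onXY h v * v 5 - 3 / 2 * onXYPR C v)
        + v 0 * (2 * v 4 * X 4 - dirDeriv X (onXYP f) v - dirDeriv X (onXY h) v * v 5
          - onXY h v * X 5 - 3 / 2 * dirDeriv X (onXYPR C) v),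
       0, -2 * (X 0 * v 4 + v 0 * X 4), 0, X 0, 0;
     0, -(X 0 * v 4 + v 0 * X 4), 0, X 0, 0, 0, 0;
     0, 3 * X 0, 0, 0, 0, 0, 0;
     0, X 0 * (4 * (onXY h v * v 4) + 3 * onXYP (pd 2 f) v - kappa f h A v * v 3
          + 3 * onXYPR B v)
        + v 0 * (4 * (dirDeriv X (onXY h) v * v 4 + onXY h v * X 4)
          + 3 * dirDeriv X (onXYP (pd 2 f)) v - dirDeriv X (kappa f h A) v * v 3
          - kappa f h A v * X 3 + 3 * dirDeriv X (onXYPR B) v),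
       X 0 * kappa f h A v + v 0 * dirDeriv X (kappa f h A) v,
       2 * (X 0 * onXY h v + v 0 * dirDeriv X (onXY h) v), -6 * X 0, 0, 0;
     X 6, 0, 0, 0, 0, 0, X 0]

lemma dirDeriv_coframe (D : IsSmoothData M ε f h A B C) {v : Fin 7 → ℝ}
    (hv : v ∈ ambientSpace M ε) (X : Fin 7 → ℝ) (a k : Fin 7) :
    dirDeriv X (fun w => coframe f h A B C w a k) v = coframeDeriv f h A B C X v a k := by
  have h1 := differentiableAt_onXYP (diffAt_xyp D.isOpen hv D.f)
  have h2 := differentiableAt_onXYP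
    (diffAt_xyp D.isOpen hv (contDiffOn_pd (isOpen_image_xyp D.isOpen) D.f 2))
  have h3 := differentiableAt_onXY (diffAt_xy D.isOpen hv D.h)
  have h4 := differentiableAt_onXYPR (diffAt_xypr D.isOpen hv D.B)
  have h5 := differentiableAt_onXYPR (diffAt_xypr D.isOpen hv D.C)
  have h6 := differentiableAt_kappa D hv
  revert a k
  simp only [coframe, coframeDeriv, Fin.forall_fin_succ, Matrix.of_apply, Matrix.cons_val_zero,
    Matrix.cons_val_succ, IsEmpty.forall_iff, and_true]
  simp (disch := fun_prop) only [dirDeriv_add, dirDeriv_sub, dirDeriv_mul,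
      dirDeriv_neg, dirDeriv_const, dirDeriv_coord, true_and, and_true]
  and_intros <;> ring

end Torsion

section Torsion

variable {M : Set (Fin 5 → ℝ)} {ε : ℝ} {f : (Fin 3 → ℝ) → ℝ} {h : (Fin 2 → ℝ) → ℝ}
  {A B C : (Fin 4 → ℝ) → ℝ}

/-- The first structure equation of the ansatz: `dθᵃ(X_b, X_c) = t (ωᵃ_b(X_c) - ωᵃ_c(X_b))`. -/
lemma coframeDeriv_torsion (D : IsSmoothData M ε f h A B C) {v : Fin 7 → ℝ}
    (hv : v ∈ ambientSpace M ε) (a b c : Fin 7) :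
    ∑ k, (coframeDeriv f h A B C (scaledFrame f h A B C v b) v a k * scaledFrame f h A B C v c k
      - coframeDeriv f h A B C (scaledFrame f h A B C v c) v a k * scaledFrame f h A B C v b k)
      = v 0 * (scaledConn f h A B C c v a b - scaledConn f h A B C b v a c) := by
  have d1 := diffAt_xyp D.isOpen hv D.f
  have d2 := diffAt_xyp D.isOpen hv (contDiffOn_pd (isOpen_image_xyp D.isOpen) D.f 2)
  have d3 := diffAt_xy D.isOpen hv D.h
  have d4 := diffAt_xypr D.isOpen hv D.B
  have d5 := diffAt_xypr D.isOpen hv D.C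
  revert a b c
  simp only [coframeDeriv, dirDeriv_onXYP d1, dirDeriv_onXYP d2, dirDeriv_onXY d3,
    dirDeriv_onXYPR d4, dirDeriv_onXYPR d5, dirDeriv_kappa D hv]
  simp only [kappa, c311, c314, c411, c411base, c413, c414, c431, c434, rhoDer, scaledFrame,
    scaledConn, skewEnd, Fin.forall_fin_succ, Fin.sum_univ_succ,
    Matrix.of_apply, Matrix.cons_val_zero, Matrix.cons_val_succ, Matrix.cons_val,
    IsEmpty.forall_iff, and_true, true_and, sub_self, Finset.univ_eq_empty, Finset.sum_empty,
    mul_zero, zero_mul, add_zero, zero_add, sub_zero, neg_zero, mul_one]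
  and_intros
  all_goals ring

end Torsion

/-! ### Derivatives of the connection coefficients -/

section Coefficients

variable {M : Set (Fin 5 → ℝ)} {ε : ℝ} {f : (Fin 3 → ℝ) → ℝ} {h : (Fin 2 → ℝ) → ℝ}
  {A B C : (Fin 4 → ℝ) → ℝ} {v : Fin 7 → ℝ}

lemma jet_c311 (D : IsSmoothData M ε f h A B C) (hv : v ∈ ambientSpace M ε) :
    DifferentiableAt ℝ (c311 f h A) v ∧ ∀ X, dirDeriv X (c311 f h A) v
      = -(1 / 2) * dirDeriv X (onXYPR (pd 2 A)) v
        - 9 / 10 * dirDeriv X (onXYP (pd 2 (pd 2 (pd 2 f)))) v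
        + 13 / 5 * dirDeriv X (onXY (pd 1 h)) v := by
  have e1 := differentiableAt_onXYPR (D.diff_A hv [2])
  have e2 := differentiableAt_onXYP (D.diff_f hv [2, 2, 2])
  have e3 := differentiableAt_onXY (D.diff_h hv [1])
  simp only [List.foldr] at e1 e2 e3
  unfold c311
  refine ⟨by fun_prop, fun X => ?_⟩
  simp (disch := fun_prop) only [dirDeriv_add, dirDeriv_sub, dirDeriv_const_mul]

lemma jet_c314 (D : IsSmoothData M ε f h A B C) (hv : v ∈ ambientSpace M ε) :
    DifferentiableAt ℝ (c314 f h A B) v ∧ ∀ X, dirDeriv X (c314 f h A B) v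
      = 1 / 18 * dirDeriv X (onXYPR A) v - 1 / 2 * dirDeriv X (onXYPR (pd 2 B)) v
        - 2 / 5 * dirDeriv X (onXYP (pd 2 (pd 2 f))) v
        - 16 / 45 * (onXY h v * dirDeriv X (onXY h) v)
        + 4 / 15 * (dirDeriv X (onXY (pd 0 h)) v + dirDeriv X (onXY (pd 1 h)) v * v 3
          + onXY (pd 1 h) v * X 3) := by
  have e1 := differentiableAt_onXYPR (D.diff_A hv [])
  have e2 := differentiableAt_onXYPR (D.diff_B hv [2])
  have e3 := differentiableAt_onXYP (D.diff_f hv [2, 2])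
  have e4 := differentiableAt_onXY (D.diff_h hv [])
  have e5 := differentiableAt_onXY (D.diff_h hv [0])
  have e6 := differentiableAt_onXY (D.diff_h hv [1])
  simp only [List.foldr] at e1 e2 e3 e4 e5 e6
  unfold c314
  refine ⟨by fun_prop, fun X => ?_⟩
  simp (disch := fun_prop) only [dirDeriv_add, dirDeriv_sub, dirDeriv_const_mul, dirDeriv_mul,
    dirDeriv_coord]
  ring

/-- The coefficient `c411base` is a function of `(x, y, p, ϱ)`. -/
lemma jet_c411base (D : IsSmoothData M ε f h A B C) (hv : v ∈ ambientSpace M ε) :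
    DifferentiableAt ℝ (c411base f h A B) v ∧
      ∀ X, X 1 = 0 → X 2 = 0 → X 3 = 0 → X 6 = 0 → dirDeriv X (c411base f h A B) v = 0 := by
  have a1 := D.diff_A hv []
  have a2 := D.diff_A hv [0]
  have a3 := D.diff_A hv [1]
  have b1 := D.diff_B hv [1]
  have f1 := D.diff_f hv [2, 2]
  have f2 := D.diff_f hv [0, 2, 2]
  have f3 := D.diff_f hv [1, 2, 2]
  have f4 := D.diff_f hv [1, 2]
  have h1 := D.diff_h hv []
  have h2 := D.diff_h hv [0]
  have h3 := D.diff_h hv [1]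
  have h4 := D.diff_h hv [0, 0]
  have h5 := D.diff_h hv [0, 1]
  have h6 := D.diff_h hv [1, 1]
  simp only [List.foldr] at a1 a2 a3 b1 f1 f2 f3 f4 h1 h2 h3 h4 h5 h6
  have a1' := differentiableAt_onXYPR a1
  have a2' := differentiableAt_onXYPR a2
  have a3' := differentiableAt_onXYPR a3
  have b1' := differentiableAt_onXYPR b1
  have f1' := differentiableAt_onXYP f1
  have f2' := differentiableAt_onXYP f2
  have f3' := differentiableAt_onXYP f3
  have f4' := differentiableAt_onXYP f4
  have h1' := differentiableAt_onXY h1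
  have h2' := differentiableAt_onXY h2
  have h3' := differentiableAt_onXY h3
  have h4' := differentiableAt_onXY h4
  have h5' := differentiableAt_onXY h5
  have h6' := differentiableAt_onXY h6
  unfold c411base
  refine ⟨by fun_prop, fun X x1 x2 x3 x6 => ?_⟩
  simp (disch := fun_prop) only [dirDeriv_add, dirDeriv_sub, dirDeriv_const_mul, dirDeriv_mul,
    dirDeriv_coord, dirDeriv_onXYPR a1, dirDeriv_onXYPR a2, dirDeriv_onXYPR a3,
    dirDeriv_onXYPR b1, dirDeriv_onXYP f1, dirDeriv_onXYP f2, dirDeriv_onXYP f3,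
    dirDeriv_onXYP f4, dirDeriv_onXY h1, dirDeriv_onXY h2, dirDeriv_onXY h3, dirDeriv_onXY h4,
    dirDeriv_onXY h5, dirDeriv_onXY h6, x1, x2, x3, x6]
  ring

lemma jet_c411 (D : IsSmoothData M ε f h A B C) (hv : v ∈ ambientSpace M ε) :
    DifferentiableAt ℝ (c411 f h A B) v ∧ ∀ X, dirDeriv X (c411 f h A B) v
      = dirDeriv X (c411base f h A B) v
        + (-(1 / 6) * dirDeriv X (onXYPR (pd 2 A)) v
          - 3 / 10 * dirDeriv X (onXYP (pd 2 (pd 2 (pd 2 f)))) v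
          + 11 / 5 * dirDeriv X (onXY (pd 1 h)) v) * v 4
        + (-(1 / 6) * onXYPR (pd 2 A) v - 3 / 10 * onXYP (pd 2 (pd 2 (pd 2 f))) v
          + 11 / 5 * onXY (pd 1 h) v) * X 4 := by
  have e1 := differentiableAt_onXYPR (D.diff_A hv [2])
  have e2 := differentiableAt_onXYP (D.diff_f hv [2, 2, 2])
  have e3 := differentiableAt_onXY (D.diff_h hv [1])
  have e4 := (jet_c411base D hv).1
  simp only [List.foldr] at e1 e2 e3
  unfold c411
  refine ⟨by fun_prop, fun X => ?_⟩
  simp (disch := fun_prop) only [dirDeriv_add, dirDeriv_sub, dirDeriv_const_mul, dirDeriv_mul,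
    dirDeriv_coord]
  ring

lemma jet_c413 (D : IsSmoothData M ε f h A B C) (hv : v ∈ ambientSpace M ε) :
    DifferentiableAt ℝ (c413 f h A B) v ∧ ∀ X, dirDeriv X (c413 f h A B) v
      = -(1 / 9) * dirDeriv X (onXYPR A) v + 1 / 2 * dirDeriv X (onXYPR (pd 2 B)) v
        + 3 / 10 * dirDeriv X (onXYP (pd 2 (pd 2 f))) v
        + 4 / 15 * (onXY h v * dirDeriv X (onXY h) v)
        - 1 / 5 * (dirDeriv X (onXY (pd 0 h)) v + dirDeriv X (onXY (pd 1 h)) v * v 3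
          + onXY (pd 1 h) v * X 3) := by
  have e1 := differentiableAt_onXYPR (D.diff_A hv [])
  have e2 := differentiableAt_onXYPR (D.diff_B hv [2])
  have e3 := differentiableAt_onXYP (D.diff_f hv [2, 2])
  have e4 := differentiableAt_onXY (D.diff_h hv [])
  have e5 := differentiableAt_onXY (D.diff_h hv [0])
  have e6 := differentiableAt_onXY (D.diff_h hv [1])
  simp only [List.foldr] at e1 e2 e3 e4 e5 e6
  unfold c413
  refine ⟨by fun_prop, fun X => ?_⟩
  simp (disch := fun_prop) only [dirDeriv_add, dirDeriv_sub, dirDeriv_const_mul, dirDeriv_mul,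
    dirDeriv_coord]
  ring

lemma jet_c414 (D : IsSmoothData M ε f h A B C) (hv : v ∈ ambientSpace M ε) :
    DifferentiableAt ℝ (c414 f h C) v ∧ ∀ X, dirDeriv X (c414 f h C) v
      = 1 / 2 * dirDeriv X (onXYPR (pd 1 C)) v + 1 / 3 * dirDeriv X (onXYP (pd 1 f)) v
        + 1 / 3 * (dirDeriv X (onXY (pd 1 h)) v * v 5 + onXY (pd 1 h) v * X 5) := by
  have e1 := differentiableAt_onXYPR (D.diff_C hv [1])
  have e2 := differentiableAt_onXYP (D.diff_f hv [1])
  have e3 := differentiableAt_onXY (D.diff_h hv [1])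
  simp only [List.foldr] at e1 e2 e3
  unfold c414
  refine ⟨by fun_prop, fun X => ?_⟩
  simp (disch := fun_prop) only [dirDeriv_add, dirDeriv_const_mul, dirDeriv_mul, dirDeriv_coord]

lemma jet_c431 (D : IsSmoothData M ε f h A B C) (hv : v ∈ ambientSpace M ε) :
    DifferentiableAt ℝ (c431 A B) v ∧ ∀ X, dirDeriv X (c431 A B) v
      = -(5 / 18) * dirDeriv X (onXYPR A) v + 1 / 2 * dirDeriv X (onXYPR (pd 2 B)) v := by
  have e1 := differentiableAt_onXYPR (D.diff_A hv [])
  have e2 := differentiableAt_onXYPR (D.diff_B hv [2])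
  simp only [List.foldr] at e1 e2
  unfold c431
  refine ⟨by fun_prop, fun X => ?_⟩
  simp (disch := fun_prop) only [dirDeriv_add, dirDeriv_const_mul]

lemma jet_c434 (D : IsSmoothData M ε f h A B C) (hv : v ∈ ambientSpace M ε) :
    DifferentiableAt ℝ (c434 B C) v ∧ ∀ X, dirDeriv X (c434 B C) v
      = -(1 / 3) * dirDeriv X (onXYPR B) v + 1 / 2 * dirDeriv X (onXYPR (pd 2 C)) v := by
  have e1 := differentiableAt_onXYPR (D.diff_B hv [])
  have e2 := differentiableAt_onXYPR (D.diff_C hv [2])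
  simp only [List.foldr] at e1 e2
  unfold c434
  refine ⟨by fun_prop, fun X => ?_⟩
  simp (disch := fun_prop) only [dirDeriv_add, dirDeriv_const_mul]

lemma jet_rhoDer {U : (Fin 4 → ℝ) → ℝ}
    (hU : DifferentiableAt ℝ (pd 3 U) (xypr (base v) (rhoCoord v))) :
    DifferentiableAt ℝ (rhoDer U) v ∧ ∀ X, dirDeriv X (rhoDer U) v
      = -(1 / 2) * (X 6 * onXYPR (pd 3 U) v + v 6 * dirDeriv X (onXYPR (pd 3 U)) v) := by
  have e1 := differentiableAt_onXYPR hU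
  unfold rhoDer
  refine ⟨by fun_prop, fun X => ?_⟩
  simp (disch := fun_prop) only [dirDeriv_const_mul, dirDeriv_mul, dirDeriv_coord]

end Coefficients

/-! ### The Ricci tensor of the ansatz -/

section Ricci

variable {M : Set (Fin 5 → ℝ)} {ε : ℝ} {f : (Fin 3 → ℝ) → ℝ} {h : (Fin 2 → ℝ) → ℝ}
  {A B C : (Fin 4 → ℝ) → ℝ} {v : Fin 7 → ℝ}

/-- The component `t² Ric(e₁, e₁)` of the Ricci tensor of the ansatz. -/
def ricA (f : (Fin 3 → ℝ) → ℝ) (A : (Fin 4 → ℝ) → ℝ) (v : Fin 7 → ℝ) : ℝ :=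
  v 6 * onXYPR (pd 3 (pd 3 A)) v - 3 / 2 * onXYPR (pd 3 A) v
    - 1 / 16 * onXYPR (pd 2 (pd 2 A)) v - 9 / 80 * onXYP (pd 2 (pd 2 (pd 2 (pd 2 f)))) v

/-- The component `t² Ric(e₁, e₄)` of the Ricci tensor of the ansatz. -/
def ricB (f : (Fin 3 → ℝ) → ℝ) (h : (Fin 2 → ℝ) → ℝ) (A B : (Fin 4 → ℝ) → ℝ)
    (v : Fin 7 → ℝ) : ℝ :=
  v 6 * onXYPR (pd 3 (pd 3 B)) v - 3 / 2 * onXYPR (pd 3 B) v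
    - 1 / 16 * onXYPR (pd 2 (pd 2 B)) v + 1 / 72 * onXYPR (pd 2 A) v
    - 3 / 80 * onXYP (pd 2 (pd 2 (pd 2 f))) v - 9 / 40 * onXY (pd 1 h) v

/-- The component `t² Ric(e₄, e₄)` of the Ricci tensor of the ansatz. -/
def ricC (f : (Fin 3 → ℝ) → ℝ) (h : (Fin 2 → ℝ) → ℝ) (A B C : (Fin 4 → ℝ) → ℝ)
    (v : Fin 7 → ℝ) : ℝ :=
  v 6 * onXYPR (pd 3 (pd 3 C)) v - 3 / 2 * onXYPR (pd 3 C) v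
    - 1 / 16 * onXYPR (pd 2 (pd 2 C)) v + 1 / 36 * onXYPR (pd 2 B) v - 1 / 648 * onXYPR A v
    - 1 / 60 * onXYP (pd 2 (pd 2 f)) v + 1 / 15 * onXY h v ^ 2
    - 1 / 10 * (v 3 * onXY (pd 1 h) v + onXY (pd 0 h) v)

/-- The matrix of the components `t² Ric(e_b, e_c)`: only those along `θ¹` and `θ⁴` survive. -/
def ricTable (f : (Fin 3 → ℝ) → ℝ) (h : (Fin 2 → ℝ) → ℝ) (A B C : (Fin 4 → ℝ) → ℝ)
    (v : Fin 7 → ℝ) : Matrix (Fin 7) (Fin 7) ℝ :=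
  !![0, 0, 0, 0, 0, 0, 0;
     0, ricA f A v, 0, 0, ricB f h A B v, 0, 0;
     0, 0, 0, 0, 0, 0, 0;
     0, 0, 0, 0, 0, 0, 0;
     0, ricB f h A B v, 0, 0, ricC f h A B C v, 0, 0;
     0, 0, 0, 0, 0, 0, 0;
     0, 0, 0, 0, 0, 0, 0]

/-- The formula `frameRicci` for the ansatz with all powers of `t` removed. The terms without
derivatives that are linear in the connection come from differentiating the factor `t⁻¹` in
`∇_{e_c} = t⁻¹ ∇_{X_c}`, where `X_a t = t` for `a = 0` and `X_a t = 0` otherwise. -/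
lemma scaledRicci_eq (D : IsSmoothData M ε f h A B C) (hv : v ∈ ambientSpace M ε) (b c : Fin 7) :
    ∑ a, (dirDeriv (scaledFrame f h A B C v a) (fun w => scaledConn f h A B C c w a b) v
        - dirDeriv (scaledFrame f h A B C v c) (fun w => scaledConn f h A B C a w a b) v)
      - scaledConn f h A B C c v 0 b
      + (![1, 0, 0, 0, 0, 0, 0] : Fin 7 → ℝ) c * ∑ a, scaledConn f h A B C a v a b
      + ∑ a, ∑ d, (scaledConn f h A B C a v a d * scaledConn f h A B C c v d b
        - scaledConn f h A B C a v d c * scaledConn f h A B C d v a b)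
      = ricTable f h A B C v b c := by
  obtain ⟨i1, j1⟩ := jet_c311 D hv
  obtain ⟨i2, j2⟩ := jet_c314 D hv
  obtain ⟨i3, j3⟩ := jet_c411 D hv
  obtain ⟨i4, j4⟩ := jet_c413 D hv
  obtain ⟨i5, j5⟩ := jet_c414 D hv
  obtain ⟨i6, j6⟩ := jet_c431 D hv
  obtain ⟨i7, j7⟩ := jet_c434 D hv
  have a0 := D.diff_A hv []
  have a2 := D.diff_A hv [2]
  have a3 := D.diff_A hv [3]
  have b0 := D.diff_B hv []
  have b2 := D.diff_B hv [2]
  have b3 := D.diff_B hv [3]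
  have c1 := D.diff_C hv [1]
  have c2 := D.diff_C hv [2]
  have c3 := D.diff_C hv [3]
  have f1 := D.diff_f hv [1]
  have f2 := D.diff_f hv [2, 2]
  have f3 := D.diff_f hv [2, 2, 2]
  have h0 := D.diff_h hv []
  have h1 := D.diff_h hv [0]
  have h2 := D.diff_h hv [1]
  simp only [List.foldr] at a0 a2 a3 b0 b2 b3 c1 c2 c3 f1 f2 f3 h0 h1 h2
  obtain ⟨iA, jA⟩ := jet_rhoDer a3
  obtain ⟨iB, jB⟩ := jet_rhoDer b3
  obtain ⟨iC, jC⟩ := jet_rhoDer c3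
  have a3' := differentiableAt_onXYPR a3
  have b3' := differentiableAt_onXYPR b3
  have c3' := differentiableAt_onXYPR c3
  have h0' := differentiableAt_onXY h0
  have k2 := (jet_c411base D hv).2 (scaledFrame f h A B C v 2) rfl rfl rfl rfl
  have k5 := (jet_c411base D hv).2 (scaledFrame f h A B C v 5) rfl rfl rfl rfl
  revert b c
  simp (disch := fun_prop) only [scaledConn, skewEnd, Fin.forall_fin_succ, Fin.sum_univ_seven,
    Matrix.of_apply, Matrix.cons_val_zero, Matrix.cons_val_succ, Matrix.cons_val,
    IsEmpty.forall_iff, and_true, true_and, sub_self, mul_zero, zero_mul,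
    add_zero, zero_add, sub_zero, neg_zero, mul_one, dirDeriv_const, dirDeriv_neg,
    dirDeriv_const_mul, ricTable]
  simp only [jA, jB, jC, j1, j2, j3, j4, j5, j6, j7, k2, k5, dirDeriv_onXYPR a0,
    dirDeriv_onXYPR a2, dirDeriv_onXYPR a3, dirDeriv_onXYPR b0, dirDeriv_onXYPR b2,
    dirDeriv_onXYPR b3, dirDeriv_onXYPR c1, dirDeriv_onXYPR c2, dirDeriv_onXYPR c3,
    dirDeriv_onXYP f1, dirDeriv_onXYP f2, dirDeriv_onXYP f3, dirDeriv_onXY h0, dirDeriv_onXY h1,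
    dirDeriv_onXY h2]
  simp only [scaledFrame, Matrix.of_apply, Matrix.cons_val_zero, Matrix.cons_val_succ,
    Matrix.cons_val, mul_zero, zero_mul, add_zero, zero_add, neg_zero, ricA, ricB, ricC,
    c311, c413, c431, true_and, and_true]
  and_intros
  all_goals ring
end Ricci

/-! ### The ansatz in the adapted coframe -/

section Metric

variable (f : (Fin 3 → ℝ) → ℝ) (h : (Fin 2 → ℝ) → ℝ) (A B C : (Fin 4 → ℝ) → ℝ) (u : Fin 5 → ℝ)

lemma theta1_eq : theta1 u = ![-u 2, 1, 0, 0, 0] := by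
  funext i; fin_cases i <;> simp [theta1, dc]

lemma theta3_eq : theta3 u = (2 * √2) • ![-u 3, 0, 1, 0, 0] := by
  funext i; fin_cases i <;> simp [theta3, dc]

lemma sqrt_two_smul_theta3 (c : ℝ) : (√2 / 2 * c) • theta3 u = (2 * c) • ![-u 3, 0, 1, 0, 0] := by
  have hs : √2 * √2 = 2 := Real.mul_self_sqrt (by norm_num)
  rw [theta3_eq, smul_smul]
  congr 1
  linear_combination c * hs

lemma symProd_theta3 : symProd (theta3 u) (theta3 u)
    = (8 : ℝ) • symProd ![-u 3, 0, 1, 0, 0] ![-u 3, 0, 1, 0, 0] := by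
  have hs : √2 * √2 = 2 := Real.mul_self_sqrt (by norm_num)
  ext i j
  simp only [theta3_eq, symProd, Matrix.smul_apply, Matrix.add_apply, Matrix.vecMulVec_apply,
    Pi.smul_apply, smul_eq_mul]
  linear_combination (4 * (![-u 3, 0, 1, 0, 0] : Fin 5 → ℝ) i
    * (![-u 3, 0, 1, 0, 0] : Fin 5 → ℝ) j) * hs

lemma theta4_eq : theta4 u = ![3, 0, 0, 0, 0] := by
  funext i; fin_cases i <;> simp [theta4, dc]

lemma theta2_eq : theta2 f h u
    = ![u 3 ^ 2 - f (xyp u) - h (xy u) * u 4, 0, -2 * u 3, 0, 1] := by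
  rw [theta2, sqrt_two_smul_theta3]
  funext i
  fin_cases i <;> (simp [dc]; try ring)

lemma theta5_eq : theta5 f h u
    = ![4 * (h (xy u) * u 3) + 3 * pd 2 f (xyp u) - 1 / 10 * (9 * pd 2 (pd 2 f) (xyp u)
        + 4 * h (xy u) ^ 2 - 6 * (u 2 * pd 1 h (xy u) + pd 0 h (xy u))) * u 2,
      1 / 10 * (9 * pd 2 (pd 2 f) (xyp u) + 4 * h (xy u) ^ 2
        - 6 * (u 2 * pd 1 h (xy u) + pd 0 h (xy u))),
      2 * h (xy u), -6, 0] := by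
  have h0 : (dc 0 : Fin 5 → ℝ) = ![1, 0, 0, 0, 0] := by
    funext i; fin_cases i <;> simp [dc]
  have h3 : (dc 3 : Fin 5 → ℝ) = ![0, 0, 0, 1, 0] := by
    funext i; fin_cases i <;> simp [dc]
  rw [theta5, show √2 * h (xy u) / 2 = √2 / 2 * h (xy u) by ring, sqrt_two_smul_theta3, theta1_eq,
    h0, h3]
  funext i
  fin_cases i <;> (simp; try ring)

/-- The components of the family of metrics on `M`. -/
lemma gDFamily_apply (r : ℝ) (i j : Fin 5) : gDFamily f h A B C u r i j
    = theta1 u i * theta5 f h u j + theta5 f h u i * theta1 u j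
      - (theta2 f h u i * theta4 u j + theta4 u i * theta2 f h u j)
      + 8 * ((![-u 3, 0, 1, 0, 0] : Fin 5 → ℝ) i * (![-u 3, 0, 1, 0, 0] : Fin 5 → ℝ) j)
      + A (xypr u r) * (theta1 u i * theta1 u j)
      + B (xypr u r) * (theta1 u i * theta4 u j + theta4 u i * theta1 u j)
      + C (xypr u r) * (theta4 u i * theta4 u j) := by
  simp only [gDFamily, gD, symProd_theta3]
  simp only [symProd, Matrix.smul_apply, Matrix.add_apply, Matrix.sub_apply,
    Matrix.vecMulVec_apply, smul_eq_mul]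
  ring

lemma baseJacobian_five : baseJacobian 5 =
    !![0, 1, 0, 0, 0, 0, 0;
       0, 0, 1, 0, 0, 0, 0;
       0, 0, 0, 1, 0, 0, 0;
       0, 0, 0, 0, 1, 0, 0;
       0, 0, 0, 0, 0, 1, 0] := by
  ext i a
  fin_cases i <;> fin_cases a <;> simp [baseJacobian, Fin.ext_iff]

/-- The ansatz is the form with Gram matrix `gram` in the adapted coframe. -/
lemma gtD_eq (v : Fin 7 → ℝ) : gtD f h A B C v
    = (coframe f h A B C v).transpose * gram * coframe f h A B C v := by
  have hd0 : (dc 0 : Fin 7 → ℝ) = ![1, 0, 0, 0, 0, 0, 0] := by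
    funext i; fin_cases i <;> simp [dc]
  have hd6 : (dc (Fin.last (5 + 1)) : Fin 7 → ℝ) = ![0, 0, 0, 0, 0, 0, 1] := by
    funext i; fin_cases i <;> simp [dc, Fin.last]
  have b2 : base v 2 = v 3 := rfl
  have b3 : base v 3 = v 4 := rfl
  have b4 : base v 4 = v 5 := rfl
  have hr : rhoCoord v = v 6 := rfl
  have ht : tCoord v = v 0 := rfl
  simp only [gtD, ambientForm, ← Matrix.ext_iff, hd0, hd6, baseJacobian_five]
  simp only [Fin.forall_fin_succ, Matrix.add_apply, Matrix.smul_apply, symProd,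
    Matrix.vecMulVec_apply, Pi.add_apply, Pi.smul_apply, smul_eq_mul, Matrix.mul_apply,
    Matrix.transpose_apply, Fin.sum_univ_seven, Fin.sum_univ_five, gDFamily_apply, coframe, gram,
    theta1_eq, theta2_eq, theta4_eq, theta5_eq, Matrix.of_apply, Matrix.cons_val_zero,
    Matrix.cons_val_succ, Matrix.cons_val, mul_zero, zero_mul, add_zero, zero_add, sub_zero,
    mul_one, one_mul, IsEmpty.forall_iff, and_true, b2, b3, b4, hr, ht]
  simp only [kappa, onXY, onXYP, onXYPR, hr, true_and]
  and_intros
  all_goals ring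

end Metric

/-! ### The Levi-Civita connection of the ansatz -/

section Ansatz

variable {M : Set (Fin 5 → ℝ)} {ε : ℝ} {f : (Fin 3 → ℝ) → ℝ} {h : (Fin 2 → ℝ) → ℝ}
  {A B C : (Fin 4 → ℝ) → ℝ} {v : Fin 7 → ℝ}

lemma mDiffAt_skewEnd {n : ℕ} {w10 w20 w30 w40 w50 w31 w41 w42 w43 w51 w53 w54 w61 w64 :
    (Fin n → ℝ) → ℝ} {v : Fin n → ℝ} (h10 : DifferentiableAt ℝ w10 v)
    (h20 : DifferentiableAt ℝ w20 v) (h30 : DifferentiableAt ℝ w30 v)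
    (h40 : DifferentiableAt ℝ w40 v) (h50 : DifferentiableAt ℝ w50 v)
    (h31 : DifferentiableAt ℝ w31 v) (h41 : DifferentiableAt ℝ w41 v)
    (h42 : DifferentiableAt ℝ w42 v) (h43 : DifferentiableAt ℝ w43 v)
    (h51 : DifferentiableAt ℝ w51 v) (h53 : DifferentiableAt ℝ w53 v)
    (h54 : DifferentiableAt ℝ w54 v) (h61 : DifferentiableAt ℝ w61 v)
    (h64 : DifferentiableAt ℝ w64 v) :
    MDiffAt (fun u => skewEnd (w10 u) (w20 u) (w30 u) (w40 u) (w50 u) (w31 u) (w41 u) (w42 u)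
      (w43 u) (w51 u) (w53 u) (w54 u) (w61 u) (w64 u)) v := by
  simp only [MDiffAt, skewEnd, Fin.forall_fin_succ, Matrix.of_apply, Matrix.cons_val_zero,
    Matrix.cons_val_succ, IsEmpty.forall_iff, and_true]
  and_intros <;> fun_prop

lemma mDiffAt_scaledConn (D : IsSmoothData M ε f h A B C) (hv : v ∈ ambientSpace M ε) :
    ∀ c, MDiffAt (scaledConn f h A B C c) v := by
  have i1 := (jet_c311 D hv).1
  have i2 := (jet_c314 D hv).1
  have i3 := (jet_c411 D hv).1
  have i4 := (jet_c413 D hv).1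
  have i5 := (jet_c414 D hv).1
  have i6 := (jet_c431 D hv).1
  have i7 := (jet_c434 D hv).1
  have a3 := differentiableAt_onXYPR (D.diff_A hv [3])
  have b3 := differentiableAt_onXYPR (D.diff_B hv [3])
  have c3 := differentiableAt_onXYPR (D.diff_C hv [3])
  have h0 := differentiableAt_onXY (D.diff_h hv [])
  simp only [List.foldr] at a3 b3 c3 h0
  have iA := (jet_rhoDer (D.diff_A hv [3])).1
  have iB := (jet_rhoDer (D.diff_B hv [3])).1
  have iC := (jet_rhoDer (D.diff_C hv [3])).1
  simp only [Fin.forall_fin_succ, IsEmpty.forall_iff, and_true]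
  and_intros <;> apply mDiffAt_skewEnd <;> fun_prop

lemma scaledConn_skew (c : Fin 7) (v : Fin 7 → ℝ) :
    gram * scaledConn f h A B C c v + (gram * scaledConn f h A B C c v).transpose = 0 := by
  revert c
  simp only [Fin.forall_fin_succ, IsEmpty.forall_iff, and_true]
  and_intros <;> exact skewEnd_skew ..

lemma gram_det_isUnit : IsUnit gram.det := by
  have h1 : gram * !![0, 0, 0, 0, 0, 0, 1;
     0, 0, 0, 0, 0, 1, 0;
     0, 0, 0, 0, -1, 0, 0;
     0, 0, 0, 1 / 8, 0, 0, 0;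
     0, 0, -1, 0, 0, 0, 0;
     0, 1, 0, 0, 0, 0, 0;
     1, 0, 0, 0, 0, 0, 0] = 1 := by
    rw [gram]
    simp only [← Matrix.ext_iff, Fin.forall_fin_succ]
    simp
  have h2 := congrArg Matrix.det h1
  rw [Matrix.det_mul, Matrix.det_one] at h2
  exact IsUnit.of_mul_eq_one _ h2

lemma gram_transpose : gram.transpose = gram := by
  rw [gram]
  simp only [← Matrix.ext_iff, Fin.forall_fin_succ]
  simp

/-- The matrices of `∇_{e_c}` in the frame dual to `coframe`. -/
def conn (f : (Fin 3 → ℝ) → ℝ) (h : (Fin 2 → ℝ) → ℝ) (A B C : (Fin 4 → ℝ) → ℝ) (c : Fin 7)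
    (v : Fin 7 → ℝ) : Matrix (Fin 7) (Fin 7) ℝ :=
  (v 0)⁻¹ • scaledConn f h A B C c v

/-- The matrices `conn` represent the Levi-Civita connection of the ansatz. -/
theorem isLeviCivitaFrame (D : IsSmoothData M ε f h A B C) :
    IsLeviCivitaFrame (ambientSpace M ε) gram (coframe f h A B C) (frame f h A B C)
      (conn f h A B C) where
  isOpen := isOpen_ambientSpace D.isOpen
  isSymm := gram_transpose
  isUnit := gram_det_isUnit
  smooth := contDiffOn_coframe D
  frame_diff v hv := mDiffAt_frame D hv
  conn_diff c v hv := fun a b =>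
    ((differentiableAt_apply 0 v).inv hv.1.ne').mul (mDiffAt_scaledConn D hv c a b)
  dual v hv := coframe_mul_frame hv.1.ne'
  metric c v hv := by
    rw [conn, Matrix.mul_smul, Matrix.transpose_smul, ← smul_add, scaledConn_skew, smul_zero]
  torsion v hv a b c := by
    have ht : v 0 ≠ 0 := hv.1.ne'
    have key := coframeDeriv_torsion D hv a b c
    simp only [frameDeriv_frame, dirDeriv_coframe D hv, frame, conn, Matrix.smul_apply,
      Matrix.transpose_apply, smul_eq_mul]
    rw [← mul_sub, show scaledConn f h A B C c v a b - scaledConn f h A B C b v a c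
      = (v 0)⁻¹ * (v 0 * (scaledConn f h A B C c v a b - scaledConn f h A B C b v a c)) by
        field_simp, ← key, ← mul_assoc, Finset.mul_sum]
    exact Finset.sum_congr rfl fun k _ => by ring

lemma frameDeriv_conn (D : IsSmoothData M ε f h A B C) (hv : v ∈ ambientSpace M ε)
    (p c a b : Fin 7) :
    frameDeriv (frame f h A B C) p (fun w => conn f h A B C c w a b) v
      = ((v 0)⁻¹) ^ 2 * (dirDeriv (scaledFrame f h A B C v p)
          (fun w => scaledConn f h A B C c w a b) v
        - (![1, 0, 0, 0, 0, 0, 0] : Fin 7 → ℝ) p * scaledConn f h A B C c v a b) := by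
  have ht : v 0 ≠ 0 := hv.1.ne'
  have hd := mDiffAt_scaledConn D hv c a b
  have h0 : scaledFrame f h A B C v p 0 = (![1, 0, 0, 0, 0, 0, 0] : Fin 7 → ℝ) p * v 0 := by
    revert p
    simp only [scaledFrame, Fin.forall_fin_succ, Matrix.of_apply, Matrix.cons_val_zero,
      Matrix.cons_val_succ, IsEmpty.forall_iff, and_true, zero_mul, one_mul]
  have hi : dirDeriv (scaledFrame f h A B C v p) (fun w : Fin 7 → ℝ => (w 0)⁻¹) v
      = -(![1, 0, 0, 0, 0, 0, 0] : Fin 7 → ℝ) p * (v 0)⁻¹ := by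
    have h1 : HasFDerivAt (fun w : Fin 7 → ℝ => (w 0)⁻¹)
        (-((v 0 ^ 2)⁻¹) • ContinuousLinearMap.proj (R := ℝ) (φ := fun _ : Fin 7 => ℝ) 0) v :=
      (hasDerivAt_inv ht).comp_hasFDerivAt v
        (ContinuousLinearMap.proj (R := ℝ) (φ := fun _ : Fin 7 => ℝ) 0).hasFDerivAt
    rw [dirDeriv_eq_fderiv, h1.fderiv]
    simp only [smul_apply, ContinuousLinearMap.proj_apply, smul_eq_mul, h0]
    field_simp
  rw [frameDeriv_frame]
  simp only [conn, Matrix.smul_apply, smul_eq_mul]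
  rw [dirDeriv_mul (F := fun w => (w 0)⁻¹) ((differentiableAt_apply 0 v).inv ht) hd, hi]
  ring

/-! ### Ricci-flatness -/

/-- The Ricci tensor of the ansatz in the frame dual to `coframe`. -/
theorem ricci_gtD (D : IsSmoothData M ε f h A B C) (hv : v ∈ ambientSpace M ε) :
    (frame f h A B C v).transpose * ricci (gtD f h A B C) v * frame f h A B C v
      = ((v 0)⁻¹) ^ 2 • ricTable f h A B C v := by
  ext b c
  rw [(isLeviCivitaFrame D).ricci_frame (fun w _ => gtD_eq f h A B C w) hv,
    IsLeviCivitaFrame.frameRicci, Matrix.smul_apply, smul_eq_mul, ← scaledRicci_eq D hv b c]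
  simp only [frameDeriv_conn D hv]
  simp only [conn, Matrix.smul_apply, smul_eq_mul]
  have h1 : ∑ a : Fin 7, (![1, 0, 0, 0, 0, 0, 0] : Fin 7 → ℝ) a * scaledConn f h A B C c v a b
      = scaledConn f h A B C c v 0 b := by
    simp [Fin.sum_univ_succ]
  rw [mul_add]
  refine congrArg₂ _ ?_ ?_
  · rw [← h1, Finset.mul_sum, ← Finset.sum_sub_distrib, ← Finset.sum_add_distrib, Finset.mul_sum]
    exact Finset.sum_congr rfl fun a _ => by ring
  · rw [Finset.mul_sum]
    refine Finset.sum_congr rfl fun a _ => ?_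
    rw [Finset.mul_sum]
    exact Finset.sum_congr rfl fun d _ => by ring

theorem ricci_gtD_eq_zero_iff (D : IsSmoothData M ε f h A B C) (hv : v ∈ ambientSpace M ε) :
    ricci (gtD f h A B C) v = 0
      ↔ ricA f A v = 0 ∧ ricB f h A B v = 0 ∧ ricC f h A B C v = 0 := by
  have ht : v 0 ≠ 0 := hv.1.ne'
  have h1 := ricci_gtD D hv
  have hd : coframe f h A B C v * frame f h A B C v = 1 := coframe_mul_frame ht
  have hd' : frame f h A B C v * coframe f h A B C v = 1 := mul_eq_one_comm.mp hd
  constructor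
  · intro h0
    rw [h0, Matrix.mul_zero, Matrix.zero_mul, eq_comm, smul_eq_zero_iff_right (by positivity)] at h1
    exact ⟨congrFun (congrFun h1 1) 1, congrFun (congrFun h1 1) 4, congrFun (congrFun h1 4) 4⟩
  · rintro ⟨hA, hB, hC⟩
    have h2 : ricTable f h A B C v = 0 := by
      rw [ricTable, hA, hB, hC]
      simp only [← Matrix.ext_iff, Fin.forall_fin_succ]
      simp
    rw [h2, smul_zero] at h1
    calc ricci (gtD f h A B C) v
        = ((frame f h A B C v * coframe f h A B C v).transpose) * ricci (gtD f h A B C) v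
          * (frame f h A B C v * coframe f h A B C v) := by
          rw [hd', Matrix.transpose_one, Matrix.one_mul, Matrix.mul_one]
      _ = (coframe f h A B C v).transpose * ((frame f h A B C v).transpose
          * ricci (gtD f h A B C) v * frame f h A B C v) * coframe f h A B C v := by
          simp only [Matrix.transpose_mul, Matrix.mul_assoc]
      _ = 0 := by rw [h1, Matrix.mul_zero, Matrix.zero_mul]

/-- Ricci-flatness at a point is the system of three partial differential equations there. -/
lemma ricci_gtD_eq_zero_iff_pde (D : IsSmoothData M ε f h A B C) (hv : v ∈ ambientSpace M ε) :
    ricci (gtD f h A B C) v = 0 ↔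
      opL A (xypr (base v) (rhoCoord v)) = 9 / 40 * pd 2 (pd 2 (pd 2 (pd 2 f))) (xyp (base v)) ∧
      opL B (xypr (base v) (rhoCoord v)) = -(1 / 36) * pd 2 A (xypr (base v) (rhoCoord v))
        + 3 / 40 * pd 2 (pd 2 (pd 2 f)) (xyp (base v)) + 9 / 20 * pd 1 h (xy (base v)) ∧
      opL C (xypr (base v) (rhoCoord v)) = -(1 / 18) * pd 2 B (xypr (base v) (rhoCoord v))
        + 1 / 324 * A (xypr (base v) (rhoCoord v)) + 1 / 30 * pd 2 (pd 2 f) (xyp (base v))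
        - 2 / 15 * h (xy (base v)) ^ 2
        + 1 / 5 * (base v 2 * pd 1 h (xy (base v)) + pd 0 h (xy (base v))) := by
  rw [ricci_gtD_eq_zero_iff D hv]
  have e1 : xypr (base v) (rhoCoord v) 3 = v 6 := rfl
  have e2 : base v 2 = v 3 := rfl
  simp only [ricA, ricB, ricC, onXY, onXYP, onXYPR, opL, e1, e2]
  refine and_congr ?_ (and_congr ?_ ?_) <;> constructor <;> intro hh <;> linarith

/-! ### Signature -/

/-- The signs of a diagonalization of `gram`. Each of the null pairs `(0, 6)`, `(1, 5)`, `(2, 4)`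
contributes one sign of each kind. -/
def signature : Fin 7 → ℤˣ := ![1, 1, -1, 1, 1, -1, -1]

lemma exists_gram_diagonal : ∃ P : Matrix (Fin 7) (Fin 7) ℝ,
    P.transpose * gram * P = Matrix.diagonal (fun i => ((signature i : ℤ) : ℝ)) := by
  have hs : √2 * √2 = 2 := Real.mul_self_sqrt (by norm_num)
  -- A null pair `(e, e')` with `⟨e, e'⟩ = ±1` is replaced by `e + ½ e'` and `e - ½ e'`.
  refine ⟨!![1, 0, 0, 0, 0, 0, 1;
     0, 1, 0, 0, 0, 1, 0;
     0, 0, 1, 0, 1, 0, 0;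
     0, 0, 0, √2 / 4, 0, 0, 0;
     0, 0, 1 / 2, 0, -(1 / 2), 0, 0;
     0, 1 / 2, 0, 0, 0, -(1 / 2), 0;
     1 / 2, 0, 0, 0, 0, 0, -(1 / 2)], ?_⟩
  simp only [← Matrix.ext_iff, Fin.forall_fin_succ, Matrix.mul_apply, Matrix.transpose_apply,
    Fin.sum_univ_seven, gram, signature, Matrix.diagonal_apply, Matrix.of_apply,
    Matrix.cons_val_zero, Matrix.cons_val_succ, Matrix.cons_val, mul_zero, zero_mul, add_zero,
    zero_add, mul_one, one_mul, IsEmpty.forall_iff, and_true]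
  simp
  and_intros <;> linarith

lemma isSemiRiemannianMetricOn_gtD (D : IsSmoothData M ε f h A B C) :
    IsSemiRiemannianMetricOn (ambientSpace M ε) (gtD f h A B C) := by
  constructor
  · intro i j
    simp only [gtD_eq, Matrix.mul_apply, Matrix.transpose_apply, Finset.sum_mul]
    exact ContDiffOn.sum fun k _ => ContDiffOn.sum fun l _ =>
      ((contDiffOn_coframe D l i).mul contDiffOn_const).mul (contDiffOn_coframe D k j)
  · obtain ⟨P, hP⟩ := exists_gram_diagonal
    refine ⟨signature, fun v hv => ⟨frame f h A B C v * P, ?_, ?_⟩⟩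
    · have hd := (isLeviCivitaFrame D).dual v hv
      have h1 := congrArg Matrix.det hd
      rw [Matrix.det_mul, Matrix.det_one, mul_comm] at h1
      have h2 : IsUnit (P.transpose * gram * P).det := by
        rw [hP, Matrix.det_diagonal, isUnit_iff_ne_zero]
        exact Finset.prod_ne_zero_iff.mpr fun i _ => by simp
      rw [Matrix.det_mul] at h2 ⊢
      exact (IsUnit.of_mul_eq_one _ h1).mul (isUnit_of_mul_isUnit_right h2)
    · rw [gtD_eq, ← hP]
      have hd := (isLeviCivitaFrame D).dual v hv
      have hd' := congrArg Matrix.transpose hd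
      rw [Matrix.transpose_mul, Matrix.transpose_one] at hd'
      calc _ = P.transpose * ((frame f h A B C v).transpose * (coframe f h A B C v).transpose)
            * gram * (coframe f h A B C v * frame f h A B C v) * P := by
            simp only [Matrix.transpose_mul, Matrix.mul_assoc]
        _ = _ := by rw [hd, hd', Matrix.mul_one, Matrix.mul_one]

/-! ### The conformal class -/

/-- The point `(t, x, ϱ)` of the ambient space. -/
def ambientPoint (t : ℝ) (u : Fin 5 → ℝ) (r : ℝ) : Fin 7 → ℝ := ![t, u 0, u 1, u 2, u 3, u 4, r]

lemma base_ambientPoint (t : ℝ) (u : Fin 5 → ℝ) (r : ℝ) : base (ambientPoint t u r) = u := by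
  funext i; fin_cases i <;> rfl

lemma ambientPoint_mem {u : Fin 5 → ℝ} {r : ℝ} (hu : u ∈ M) (hr : r ∈ Set.Ioo (-ε) ε) :
    ambientPoint 1 u r ∈ ambientSpace M ε :=
  ⟨one_pos, (base_ambientPoint 1 u r).symm ▸ hu, hr⟩

/-- The components of `2 dt d(ϱ t) + t² g` along `M`, which recover `g`. -/
lemma ambientForm_apply_base {n : ℕ} (g : (Fin n → ℝ) → ℝ → Matrix (Fin n) (Fin n) ℝ)
    (v : Fin (n + 2) → ℝ) (i j : Fin n) :
    ambientForm g v i.succ.castSucc j.succ.castSucc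
      = tCoord v ^ 2 * g (base v) (rhoCoord v) i j := by
  have h0 : ∀ i : Fin n, (dc 0 : Fin (n + 2) → ℝ) i.castSucc.succ = 0 := fun i => by
    simp [dc]
  simp [ambientForm, symProd, Matrix.vecMulVec_apply, h0, Matrix.mul_apply, baseJacobian]

/-- If the family at `ϱ = 0` is conformal to `gD`, then it equals `gD`: the `dp²` coefficient `8` is
not affected by `A`, `B`, `C`. -/
lemma coeff_eq_zero_of_conformal {u : Fin 5 → ℝ} {s : ℝ}
    (hs : gDFamily f h A B C u 0 = s • gD f h u) :
    A (xypr u 0) = 0 ∧ B (xypr u 0) = 0 ∧ C (xypr u 0) = 0 := by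
  have h0 : gD f h u = gDFamily f h (fun _ => 0) (fun _ => 0) (fun _ => 0) u 0 := by
    simp [gDFamily]
  have e : ∀ i j, gDFamily f h A B C u 0 i j = s * gD f h u i j := fun i j => by
    rw [hs, Matrix.smul_apply, smul_eq_mul]
  -- The coefficient of `dp²` fixes the conformal factor.
  have h22 := e 2 2
  have h11 := e 1 1
  have h01 := e 0 1
  have h00 := e 0 0
  simp only [h0, gDFamily_apply, theta1_eq, theta2_eq, theta4_eq, theta5_eq, Matrix.cons_val]
    at h22 h11 h01 h00
  have hs1 : s = 1 := by linarith
  subst hs1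
  have hA : A (xypr u 0) = 0 := by linarith
  have hB : B (xypr u 0) = 0 := by rw [hA] at h01; linarith
  refine ⟨hA, hB, ?_⟩
  rw [hA, hB] at h00
  linarith

end Ansatz

end DistAmbient

end

theorem mainTheorem3
    (M : Set (Fin 5 → ℝ)) (hM : IsOpen M) (ε : ℝ) (hε : 0 < ε)
    (f : (Fin 3 → ℝ) → ℝ) (h : (Fin 2 → ℝ) → ℝ) (A B C : (Fin 4 → ℝ) → ℝ)
    (hf : ContDiffOn ℝ ∞ f (xyp '' M))
    (hh : ContDiffOn ℝ ∞ h (xy '' M))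
    (hA : ContDiffOn ℝ ∞ A (Set.image2 xypr M (Set.Ioo (-ε) ε)))
    (hB : ContDiffOn ℝ ∞ B (Set.image2 xypr M (Set.Ioo (-ε) ε)))
    (hC : ContDiffOn ℝ ∞ C (Set.image2 xypr M (Set.Ioo (-ε) ε))) :
    IsAmbientMetricForClass M ε (conformalClass M (gD f h)) (gtD f h A B C) ↔
      ((∀ u ∈ M, A (xypr u 0) = 0 ∧ B (xypr u 0) = 0 ∧ C (xypr u 0) = 0) ∧
       ∀ u ∈ M, ∀ r ∈ Set.Ioo (-ε) ε,
        opL A (xypr u r) = 9 / 40 * pd 2 (pd 2 (pd 2 (pd 2 f))) (xyp u) ∧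
        opL B (xypr u r) = -(1 / 36) * pd 2 A (xypr u r)
          + 3 / 40 * pd 2 (pd 2 (pd 2 f)) (xyp u) + 9 / 20 * pd 1 h (xy u) ∧
        opL C (xypr u r) = -(1 / 18) * pd 2 B (xypr u r) + 1 / 324 * A (xypr u r)
          + 1 / 30 * pd 2 (pd 2 f) (xyp u) - 2 / 15 * h (xy u) ^ 2
          + 1 / 5 * (u 2 * pd 1 h (xy u) + pd 0 h (xy u))) := by
  have D : IsSmoothData M ε f h A B C := ⟨hM, hf, hh, hA, hB, hC⟩
  have h0 : (0 : ℝ) ∈ Set.Ioo (-ε) ε := ⟨by linarith, hε⟩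
  constructor
  · rintro ⟨g₀, ⟨φ, -, hφ⟩, ⟨-, g, hg, hg₀⟩, hric⟩
    refine ⟨fun u hu => ?_, fun u hu r hr => ?_⟩
    · have hv := ambientPoint_mem hu h0
      refine coeff_eq_zero_of_conformal (f := f) (h := h)
        (s := Real.exp (2 * φ u)) ?_
      rw [← hφ u hu, ← hg₀ u hu]
      ext i j
      have h1 := congrFun (congrFun (hg _ hv) i.succ.castSucc) j.succ.castSucc
      rw [gtD, ambientForm_apply_base, ambientForm_apply_base, base_ambientPoint] at h1
      exact mul_left_cancel₀ (pow_ne_zero 2 one_ne_zero) h1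
    · have hv := ambientPoint_mem hu hr
      have h1 := (ricci_gtD_eq_zero_iff_pde D hv).1 (hric _ hv)
      rwa [base_ambientPoint] at h1
  · rintro ⟨hz, hpde⟩
    refine ⟨gD f h, ⟨fun _ => 0, contDiffOn_const, fun u _ => by simp⟩,
      ⟨isSemiRiemannianMetricOn_gtD D, gDFamily f h A B C, fun _ _ => rfl, fun u hu => ?_⟩,
      fun v hv => (ricci_gtD_eq_zero_iff_pde D hv).2 (hpde _ hv.2.1 _ hv.2.2)⟩
    obtain ⟨h1, h2, h3⟩ := hz u hu
    simp [gDFamily, h1, h2, h3]
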